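/- **Conventions.** For $n\ge 0$ let $[n]=\{1,\dots,n\}$. For a set partition $\pi\vdash[n]$ (for $n=0$ there is just the empty one, $\emptyset$) let $\lambda(\pi)\vdash n$ be the integer partition formed by its block sizes. For an integer partition $\lambda=(\lambda_1\ge\dots\ge\lambda_\ell>0)$ put $\lambda!=\lambda_1!\cdots\lambda_\ell!$. In $\mathbb{Q}\langle\langle x_1,x_2,\dots\rangle\rangle$ (noncommuting variables) let $m_\pi=\sum x_{i_1}\cdots x_{i_n}$, summed over all tuples with $i_j=i_k$ if and only if $j,k$ lie in the same block of $\pi$ (so $m_\emptyset=1$), and $h_\pi=\sum_{\sigma\vdash[n]}\lambda(\sigma\wedge\pi)!\,m_\sigma$, where $\wedge$ is the meet in the refinement order. $\mathrm{NCSym}$ is the $\mathbb{Q}$-span of all $m_\pi$, $\pi\vdash[n]$, $n\ge0$. A permutation $\delta\in\mathfrak S_n$ acts on the degree $n$ part linearly by $\delta\circ m_\pi=m_{\delta\pi}$ (equivalently $\delta\circ h_\pi=h_{\delta\pi}$), where the blocks of $\delta\pi$ are the images under $\delta$ of the blocks of $\pi$. Let $\rho:\mathbb{Q}\langle\langle x_1,x_2,\dots\rangle\rangle\to\mathbb{Q}[[x_1,x_2,\dots]]$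 be the map that lets the variables commute. For $\lambda\vdash n$ with $\ell$ parts define $$s_{[\lambda]}=\sum_{\varepsilon\in\mathfrak S_\ell}\mathrm{sgn}(\varepsilon)\,a_{1\varepsilon(1)}a_{2\varepsilon(2)}\cdots a_{\ell\varepsilon(\ell)},\qquad a_{ij}=\frac{1}{(\lambda_i-i+j)!}\,h_{[\lambda_i-i+j]},$$ where $h_{[k]}$ is $h_\pi$ for the one-block set partition $\pi$ of $[k]$, $h_{[0]}=1$, and $a_{ij}=0$ if $\lambda_i-i+j<0$. Let $s_\lambda=\det(h_{\lambda_i-i+j})_{1\le i,j\le\ell}$ be the classical Schur function. A Young tableau $t$ of shape $\mathrm{sh}(t)=\lambda\vdash n$ is a bijective filling of the diagram of $\lambda$ with $1,\dots,n$; $\delta_t\in\mathfrak S_n$ is the permutation whose one-line notation is obtained by reading the rows of $t$ from left to right, from the top row to the bottom row. Two tableaux of the same shape are row equivalent if, for every $i$, their $i$th rows contain the same elements. Put $$s_{[t]}=\sum_{t'}\delta_{t'}\circ s_{[\mathrm{sh}(t')]},$$ the sum being over all Young tableaux $t'$ row equivalent to $t$. For a set partition $\pi\vdash[n]$ there is a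 unique Young tableau $t$ of shape $\lambda(\pi)$ whose rows increase from left to right, whose sets of row entries are exactly the blocks of $\pi$, and in which, among the rows of any given length, the leftmost entries increase from top to bottom; put $\delta_\pi=\delta_t$ for this $t$. **Theorem.** The family $$\{\,s_{[t]} : \mathrm{sh}(t)=\lambda(\pi),\ \delta_t=\delta_\pi\,\}_{\pi\vdash[n],\ n\ge 0}$$ (one function for each set partition $\pi$) is a basis of the $\mathbb{Q}$-vector space $\mathrm{NCSym}$. Moreover, for every integer partition $\lambda\vdash n$, $n\geq 0$, and every Young tableau $t$ of shape $\lambda$, $$\rho(s_{[t]})=\mathrm{sh}(t)!\;s_{\mathrm{sh}(t)}.$$ -/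

import Mathlib

namespace NCS

/-! ### Formal power series in noncommuting variables -/

/-- The space `ℚ⟨⟨x₁, x₂, …⟩⟩` of formal power series in countably many noncommuting variables:
a series is given by its coefficients, where a word `x_{i₁} x_{i₂} ⋯ x_{iₖ}` is recorded as the
list `[i₁, i₂, …, iₖ]`. -/
@[ext]
structure NCSeries where
  /-- The coefficient of a word. -/
  coeff : List ℕ → ℚ

noncomputable section

namespace NCSeries

/-- A series is the same thing as its coefficient function. -/
def equivFun : NCSeries ≃ (List ℕ → ℚ) where
  toFun := coeff
  invFun := mk
  left_inv _ := rfl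
  right_inv _ := rfl

instance : AddCommGroup NCSeries := equivFun.addCommGroup

instance : Module ℚ NCSeries := equivFun.module ℚ

instance : One NCSeries := ⟨⟨fun w => if w = [] then 1 else 0⟩⟩

/-- The concatenation product: the coefficient of `w` in `f * g` is the sum of the products of
the coefficient of `u` in `f` and that of `v` in `g`, over all factorizations `w = u v`. -/
instance : Mul NCSeries :=
  ⟨fun f g => ⟨fun w => ∑ p ∈ Finset.HasAntidiagonal.antidiagonal w.length,
    f.coeff (w.take p.1) * g.coeff (w.drop p.1)⟩⟩

theorem coeff_one (w : List ℕ) : (1 : NCSeries).coeff w = if w = [] then 1 else 0 := rfl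

theorem coeff_zero (w : List ℕ) : (0 : NCSeries).coeff w = 0 := rfl

theorem coeff_add (f g : NCSeries) (w : List ℕ) : (f + g).coeff w = f.coeff w + g.coeff w := rfl

theorem coeff_smul (c : ℚ) (f : NCSeries) (w : List ℕ) : (c • f).coeff w = c * f.coeff w := rfl

theorem coeff_mul (f g : NCSeries) (w : List ℕ) :
    (f * g).coeff w = ∑ p ∈ Finset.HasAntidiagonal.antidiagonal w.length,
      f.coeff (w.take p.1) * g.coeff (w.drop p.1) := rfl

theorem coeff_sum {ι : Type*} (s : Finset ι) (f : ι → NCSeries) (w : List ℕ) :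
    (∑ i ∈ s, f i).coeff w = ∑ i ∈ s, (f i).coeff w :=
  map_sum (AddMonoidHom.mk' (fun g : NCSeries => g.coeff w) fun _ _ => rfl) f s

protected theorem mul_assoc (f g h : NCSeries) : f * g * h = f * (g * h) := by
  ext w
  simp only [coeff_mul, Finset.sum_mul, Finset.mul_sum, Finset.sum_sigma']
  refine Finset.sum_nbij' (fun x => ⟨(x.2.1, x.2.2 + x.1.2), (x.2.2, x.1.2)⟩)
    (fun x => ⟨(x.1.1 + x.2.1, x.2.2), (x.1.1, x.2.1)⟩) ?_ ?_ ?_ ?_ ?_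
  · rintro ⟨⟨i, j⟩, ⟨k, l⟩⟩ hx
    simp only [Finset.mem_sigma, Finset.HasAntidiagonal.mem_antidiagonal, List.length_take,
      List.length_drop] at hx ⊢
    omega
  · rintro ⟨⟨i, j⟩, ⟨k, l⟩⟩ hx
    simp only [Finset.mem_sigma, Finset.HasAntidiagonal.mem_antidiagonal, List.length_take,
      List.length_drop] at hx ⊢
    omega
  · rintro ⟨⟨i, j⟩, ⟨k, l⟩⟩ hx
    simp only [Finset.mem_sigma, Finset.HasAntidiagonal.mem_antidiagonal, List.length_take] at hx
    obtain ⟨h1, h2⟩ := hx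
    have : k + l = i := by omega
    subst this
    rfl
  · rintro ⟨⟨i, j⟩, ⟨k, l⟩⟩ hx
    simp only [Finset.mem_sigma, Finset.HasAntidiagonal.mem_antidiagonal, List.length_drop] at hx
    obtain ⟨h1, h2⟩ := hx
    have : k + l = j := by omega
    subst this
    rfl
  · rintro ⟨⟨i, j⟩, ⟨k, l⟩⟩ hx
    simp only [Finset.mem_sigma, Finset.HasAntidiagonal.mem_antidiagonal, List.length_take] at hx
    obtain ⟨h1, h2⟩ := hx
    have : i = k + l := by omega
    subst this
    simp [List.take_take, List.drop_take, List.drop_drop, mul_assoc]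

protected theorem one_mul (f : NCSeries) : 1 * f = f := by
  ext w
  rw [coeff_mul, Finset.sum_eq_single (0, w.length)]
  · simp [coeff_one]
  · rintro ⟨i, j⟩ hp hne
    rw [Finset.HasAntidiagonal.mem_antidiagonal] at hp
    have : ¬ w.take i = [] := by
      rw [List.take_eq_nil_iff]
      rintro (rfl | rfl)
      · exact hne (by simp_all)
      · exact hne (by simp_all)
    simp [coeff_one, this]
  · simp

protected theorem mul_one (f : NCSeries) : f * 1 = f := by
  ext w
  rw [coeff_mul, Finset.sum_eq_single (w.length, 0)]
  · simp [coeff_one]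
  · rintro ⟨i, j⟩ hp hne
    rw [Finset.HasAntidiagonal.mem_antidiagonal] at hp
    have : ¬ w.drop i = [] := by
      rw [List.drop_eq_nil_iff]
      intro h
      exact hne (by ext <;> simp at * <;> omega)
    simp [coeff_one, this]
  · simp

instance : Ring NCSeries :=
  { (inferInstance : AddCommGroup NCSeries) with
    mul := (· * ·)
    one := 1
    mul_assoc := NCSeries.mul_assoc
    one_mul := NCSeries.one_mul
    mul_one := NCSeries.mul_one
    zero_mul := fun f => by
      ext w
      simp [coeff_mul, coeff_zero]
    mul_zero := fun f => by
      ext w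
      simp [coeff_mul, coeff_zero]
    left_distrib := fun f g h => by
      ext w
      simp [coeff_mul, coeff_add, mul_add, Finset.sum_add_distrib]
    right_distrib := fun f g h => by
      ext w
      simp [coeff_mul, coeff_add, add_mul, Finset.sum_add_distrib] }

/-- The noncommutative Leibniz determinant: each product is taken from the top row to the
bottom row. -/
def det {k : ℕ} (A : Fin k → Fin k → NCSeries) : NCSeries :=
  ∑ ε : Equiv.Perm (Fin k),
    (Equiv.Perm.sign ε : ℤ) • (List.ofFn fun i => A i (ε i)).prod

/-- The projection map `ρ : ℚ⟨⟨x₁, x₂, …⟩⟩ → ℚ[[x₁, x₂, …]]` that lets the variables commute: the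
coefficient of a commutative monomial is the sum of the coefficients of the (finitely many)
words that are rearrangements of it. -/
def rho : NCSeries →ₗ[ℚ] MvPowerSeries ℕ ℚ where
  toFun f := fun d => ∑ w ∈ (Multiset.lists (Finsupp.toMultiset d)).toFinset, f.coeff w
  map_add' f g := by
    funext d
    exact Finset.sum_add_distrib
  map_smul' c f := by
    funext d
    exact (Finset.mul_sum _ _ _).symm

/-- The action `f ↦ δ ∘ f` of a permutation of `[n]` on the places of words of length `n`: the
coefficient of `x_{i₁} ⋯ x_{iₙ}` in `δ ∘ f` is the coefficient of `x_{i_{δ(1)}} ⋯ x_{i_{δ(n)}}`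
in `f`. It is only ever applied to series that are homogeneous of degree `n`; the components of
other degrees are sent to `0`. -/
def permAct {n : ℕ} (δ : Equiv.Perm (Fin n)) : NCSeries →ₗ[ℚ] NCSeries where
  toFun f := ⟨fun w =>
    if h : w.length = n then
      f.coeff (List.ofFn fun i : Fin n => w.get (Fin.cast h.symm (δ i)))
    else 0⟩
  map_add' f g := by
    ext w
    simp only [coeff_add]
    split_ifs
    · rfl
    · exact (add_zero 0).symm
  map_smul' c f := by
    ext w
    simp only [coeff_smul, RingHom.id_apply]
    split_ifs
    · rfl
    · exact (mul_zero c).symm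

end NCSeries

/-! ### Integer partitions -/

/-- The parts `λ₁ ≥ λ₂ ≥ ⋯` of an integer partition, in weakly decreasing order. -/
def rows {n : ℕ} (lam : n.Partition) : List ℕ := lam.parts.sort (· ≥ ·)

/-- `λ! = λ₁! λ₂! ⋯`. -/
def partFactorial {n : ℕ} (lam : n.Partition) : ℕ := (lam.parts.map Nat.factorial).prod

theorem sum_rows {n : ℕ} (lam : n.Partition) : (rows lam).sum = n := by
  have h : ((rows lam : List ℕ) : Multiset ℕ).sum = lam.parts.sum := by
    rw [rows, Multiset.sort_eq]
  rw [Multiset.sum_coe, lam.parts_sum] at h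
  exact h

theorem rows_pos {n : ℕ} (lam : n.Partition) (i : Fin (rows lam).length) :
    0 < (rows lam).get i :=
  lam.parts_pos ((Multiset.mem_sort (· ≥ ·)).1 (List.get_mem (rows lam) i))

/-! ### Set partitions and the algebra NCSym -/

/-- Set partitions of `[n]`, with `[n]` modelled by `Fin n`. The order `≤` on this type is
refinement, `⊓` is the greatest lower bound and `⊤` has the single block `[n]` (no block if
`n = 0`). -/
abbrev SetPartition (n : ℕ) : Type := Finpartition (Finset.univ : Finset (Fin n))

namespace SetPartition

/-- The integer partition `λ(π)` formed by the block sizes of `π`. -/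
def shape {n : ℕ} (π : SetPartition n) : n.Partition where
  parts := π.parts.val.map Finset.card
  parts_pos := by
    intro i hi
    obtain ⟨B, hB, rfl⟩ := Multiset.mem_map.1 hi
    exact Finset.card_pos.2 (π.nonempty_of_mem_parts hB)
  parts_sum := by
    have h := π.sum_card_parts
    rw [Finset.card_univ, Fintype.card_fin] at h
    exact h

/-- The monomial symmetric function `m_π`: the sum of all words `x_{i₁} ⋯ x_{iₙ}` such that
`i_j = i_k` if and only if `j` and `k` are in the same block of `π`. -/
def monomial {n : ℕ} (π : SetPartition n) : NCSeries where
  coeff w := open Classical in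
    if ∃ h : w.length = n, ∀ j k : Fin n,
        w.get (Fin.cast h.symm j) = w.get (Fin.cast h.symm k) ↔ π.part j = π.part k
    then 1 else 0

/-- The complete homogeneous symmetric function `h_π = ∑_σ λ(σ ∧ π)! m_σ`. -/
def complete {n : ℕ} (π : SetPartition n) : NCSeries :=
  ∑ σ : SetPartition n, (partFactorial (shape (σ ⊓ π)) : ℚ) • σ.monomial

/-- The natural action of a permutation on set partitions: the blocks of `δπ` are the `δ(B)`, for
`B` a block of `π`. -/
def perm {n : ℕ} (δ : Equiv.Perm (Fin n)) (π : SetPartition n) : SetPartition n :=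
  (π.map (δ.finsetCongr.toOrderIso (fun _ _ h => Finset.map_subset_map.2 h)
    (fun _ _ h => Finset.map_subset_map.2 h))).copy (by
      change Finset.univ.map δ.toEmbedding = Finset.univ
      exact Finset.map_univ_equiv δ)

variable {n : ℕ}

theorem mem_parts_perm (δ : Equiv.Perm (Fin n)) (π : SetPartition n) (B : Finset (Fin n)) :
    B ∈ (perm δ π).parts ↔ ∃ C ∈ π.parts, C.map δ.toEmbedding = B := by
  change B ∈ π.parts.map _ ↔ _
  rw [Finset.mem_map]
  rfl

theorem part_perm (δ : Equiv.Perm (Fin n)) (π : SetPartition n) (j : Fin n) :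
    (perm δ π).part (δ j) = (π.part j).map δ.toEmbedding :=
  (perm δ π).part_eq_of_mem
    ((mem_parts_perm δ π _).2 ⟨_, π.part_mem.2 (Finset.mem_univ j), rfl⟩)
    (Finset.mem_map_of_mem _ (π.mem_part (Finset.mem_univ j)))

/-- The action on places satisfies `δ ∘ m_π = m_{δπ}`. -/
theorem permAct_monomial (δ : Equiv.Perm (Fin n)) (π : SetPartition n) :
    NCSeries.permAct δ π.monomial = (perm δ π).monomial := by
  classical
  ext w
  by_cases h : w.length = n
  · subst h
    simp only [NCSeries.permAct, monomial, LinearMap.coe_mk, AddHom.coe_mk, List.length_ofFn,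
      exists_true_left, dite_true]
    congr 1
    rw [eq_iff_iff]
    conv_rhs => rw [← δ.forall_congr_right]
    refine forall_congr' fun j => ?_
    conv_rhs => rw [← δ.forall_congr_right]
    refine forall_congr' fun k => ?_
    rw [part_perm, part_perm, Finset.map_inj]
    simp
  · simp [NCSeries.permAct, monomial, h]

theorem perm_le_perm (δ : Equiv.Perm (Fin n)) {π σ : SetPartition n} (h : π ≤ σ) :
    perm δ π ≤ perm δ σ := by
  intro B hB
  obtain ⟨C, hC, rfl⟩ := (mem_parts_perm δ π B).1 hB
  obtain ⟨D, hD, hCD⟩ := h hC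
  exact ⟨_, (mem_parts_perm δ σ _).2 ⟨D, hD, rfl⟩, Finset.map_subset_map.2 hCD⟩

theorem perm_symm_perm (δ : Equiv.Perm (Fin n)) (π : SetPartition n) :
    perm δ.symm (perm δ π) = π := by
  apply Finpartition.ext
  ext B
  simp only [mem_parts_perm]
  constructor
  · rintro ⟨C, ⟨D, hD, rfl⟩, rfl⟩
    simpa [Finset.map_map] using hD
  · intro hB
    exact ⟨_, ⟨B, hB, rfl⟩, by simp [Finset.map_map]⟩

theorem perm_inf (δ : Equiv.Perm (Fin n)) (π σ : SetPartition n) :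
    perm δ (π ⊓ σ) = perm δ π ⊓ perm δ σ := by
  apply le_antisymm
  · exact le_inf (perm_le_perm δ inf_le_left) (perm_le_perm δ inf_le_right)
  · have h := perm_le_perm δ (le_inf
      ((perm_le_perm δ.symm (inf_le_left (a := perm δ π) (b := perm δ σ))).trans_eq
        (perm_symm_perm δ π))
      ((perm_le_perm δ.symm (inf_le_right (a := perm δ π) (b := perm δ σ))).trans_eq
        (perm_symm_perm δ σ)))
    have e := perm_symm_perm δ.symm (perm δ π ⊓ perm δ σ)
    rw [Equiv.symm_symm] at e
    rwa [e] at h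

theorem shape_perm (δ : Equiv.Perm (Fin n)) (π : SetPartition n) :
    (perm δ π).shape = π.shape := by
  apply Nat.Partition.ext
  change (π.parts.map _).val.map Finset.card = π.parts.val.map Finset.card
  rw [Finset.map_val, Multiset.map_map]
  refine Multiset.map_congr rfl fun B _ => ?_
  exact Finset.card_map δ.toEmbedding

/-- The action on places satisfies `δ ∘ h_π = h_{δπ}`. -/
theorem permAct_complete (δ : Equiv.Perm (Fin n)) (π : SetPartition n) :
    NCSeries.permAct δ π.complete = (perm δ π).complete := by
  rw [complete, complete, map_sum]
  refine Fintype.sum_equiv ⟨perm δ, perm δ.symm, perm_symm_perm δ, fun σ => ?_⟩ _ _ fun σ => ?_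
  · have e := perm_symm_perm δ.symm σ
    rwa [Equiv.symm_symm] at e
  · rw [map_smul, permAct_monomial]
    change _ = (partFactorial (shape (perm δ σ ⊓ perm δ π)) : ℚ) • (perm δ σ).monomial
    rw [← perm_inf, shape_perm]

/-- The empty set partition gives the constant series `1`. -/
theorem monomial_zero (π : SetPartition 0) : π.monomial = 1 := by
  ext w
  simp [monomial, NCSeries.coeff_one]

end SetPartition

/-- The algebra of symmetric functions in noncommuting variables, as the subspace of
`ℚ⟨⟨x₁, x₂, …⟩⟩` spanned by the `m_π`, for all set partitions `π` of `[n]` and all `n ≥ 0`. -/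
def NCSym : Submodule ℚ NCSeries :=
  Submodule.span ℚ (Set.range fun p : (Σ n : ℕ, SetPartition n) => p.2.monomial)

/-! ### Young tableaux -/

/-- The boxes of the diagram of `λ`: pairs (row `i`, column `j`) with `1 ≤ i ≤ ℓ(λ)` and
`1 ≤ j ≤ λ_i` (both coordinates counted from `0`). -/
abbrev Box {n : ℕ} (lam : n.Partition) : Type :=
  Σ i : Fin (rows lam).length, Fin ((rows lam).get i)

/-- Young tableaux `t` of shape `sh(t) = λ ⊢ n`: bijective fillings of the boxes of `λ` with the
elements of `[n]`. -/
abbrev YoungTableau {n : ℕ} (lam : n.Partition) : Type := Box lam ≃ Fin n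

/-- The reading order of the boxes: rows from top to bottom, each row from left to right. -/
def readingOrder {n : ℕ} (lam : n.Partition) : Box lam ≃ Fin n :=
  finSigmaFinEquiv.trans (finCongr (by
    rw [← List.sum_ofFn, List.ofFn_get, sum_rows]))

namespace YoungTableau

variable {n : ℕ} {lam : n.Partition}

/-- The permutation `δ_t`: its one-line notation is the reading word of `t`. -/
def perm (t : YoungTableau lam) : Equiv.Perm (Fin n) := (readingOrder lam).symm.trans t

/-- The set of entries of row `i`. -/
def rowSet (t : YoungTableau lam) (i : Fin (rows lam).length) : Finset (Fin n) :=
  Finset.univ.image fun j => t ⟨i, j⟩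

/-- Row equivalence of two tableaux of the same shape. -/
def RowEquiv (t t' : YoungTableau lam) : Prop := ∀ i, t.rowSet i = t'.rowSet i

/-- The conditions determining the tableau that corresponds to a set partition `π`: rows increase
from left to right, the leftmost entries of the rows of any given length increase from top to
bottom, and the sets of entries of the rows are precisely the blocks of `π`. -/
structure Represents {π : SetPartition n} (t : YoungTableau π.shape) : Prop where
  row_lt : ∀ i (j k : Fin ((rows π.shape).get i)), j < k → t ⟨i, j⟩ < t ⟨i, k⟩
  first_lt : ∀ (i j : Fin (rows π.shape).length) (a : Fin ((rows π.shape).get i))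
    (b : Fin ((rows π.shape).get j)), i < j → (rows π.shape).get i = (rows π.shape).get j →
      (a : ℕ) = 0 → (b : ℕ) = 0 → t ⟨i, a⟩ < t ⟨j, b⟩
  image_rowSet : Finset.univ.image t.rowSet = π.parts

end YoungTableau

namespace SetPartition

variable {n : ℕ}

/-- An auxiliary order on blocks: larger blocks first, ties broken by least elements. -/
def blockLE (A B : Finset (Fin n)) : Prop :=
  B.card < A.card ∨ (A.card = B.card ∧ A.min ≤ B.min)

theorem blockLE_total (A B : Finset (Fin n)) : blockLE A B ∨ blockLE B A := by
  unfold blockLE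
  rcases lt_trichotomy A.card B.card with h | h | h
  · exact Or.inr (Or.inl h)
  · rcases le_total A.min B.min with h' | h'
    · exact Or.inl (Or.inr ⟨h, h'⟩)
    · exact Or.inr (Or.inr ⟨h.symm, h'⟩)
  · exact Or.inl (Or.inl h)

theorem blockLE_trans {A B C : Finset (Fin n)} (h₁ : blockLE A B) (h₂ : blockLE B C) :
    blockLE A C := by
  unfold blockLE at *
  rcases h₁ with h₁ | ⟨h₁, h₁'⟩ <;> rcases h₂ with h₂ | ⟨h₂, h₂'⟩
  · exact Or.inl (by omega)
  · exact Or.inl (by omega)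
  · exact Or.inl (by omega)
  · exact Or.inr ⟨by omega, h₁'.trans h₂'⟩

theorem blockLE_antisymm (π : SetPartition n) {A B : Finset (Fin n)} (hA : A ∈ π.parts)
    (hB : B ∈ π.parts) (h₁ : blockLE A B) (h₂ : blockLE B A) : A = B := by
  unfold blockLE at *
  have hmin : A.min = B.min := by
    rcases h₁ with h₁ | ⟨h₁, h₁'⟩ <;> rcases h₂ with h₂ | ⟨h₂, h₂'⟩
    · omega
    · omega
    · omega
    · exact le_antisymm h₁' h₂'
  obtain ⟨a, ha⟩ := Finset.min_of_nonempty (π.nonempty_of_mem_parts hA)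
  exact π.eq_of_mem_parts hA hB (Finset.mem_of_min ha) (Finset.mem_of_min (hmin ▸ ha))

theorem exists_blockList (π : SetPartition n) :
    ∃ L : List (Finset (Fin n)), L.Pairwise blockLE ∧ (L : Multiset (Finset (Fin n))) =
      π.parts.val ∧ L.map Finset.card = rows π.shape := by
  classical
  refine ⟨π.parts.toList.mergeSort (fun A B => decide (blockLE A B)), ?_, ?_, ?_⟩
  · have h := List.pairwise_mergeSort (le := fun A B : Finset (Fin n) => decide (blockLE A B))
      (fun A B C h₁ h₂ => by simpa using blockLE_trans (by simpa using h₁) (by simpa using h₂))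
      (fun A B => by simpa using blockLE_total A B) π.parts.toList
    simpa using h
  · rw [← Finset.coe_toList, Multiset.coe_eq_coe]
    exact List.mergeSort_perm _ _
  · have hp : (List.map Finset.card
        (π.parts.toList.mergeSort (fun A B => decide (blockLE A B)))).Perm (rows π.shape) := by
      rw [← Multiset.coe_eq_coe, rows, Multiset.sort_eq, ← Multiset.map_coe]
      change _ = π.parts.val.map Finset.card
      congr 1
      rw [← Finset.coe_toList, Multiset.coe_eq_coe]
      exact List.mergeSort_perm _ _
    refine hp.eq_of_pairwise (le := (· ≥ ·)) (fun _ _ _ _ h₁ h₂ => le_antisymm h₂ h₁) ?_ ?_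
    · rw [List.pairwise_map]
      have h := List.pairwise_mergeSort (le := fun A B : Finset (Fin n) => decide (blockLE A B))
        (fun A B C h₁ h₂ => by simpa using blockLE_trans (by simpa using h₁) (by simpa using h₂))
        (fun A B => by simpa using blockLE_total A B) π.parts.toList
      refine h.imp ?_
      intro A B hAB
      have hAB' : blockLE A B := by simpa using hAB
      rcases hAB' with h' | h'
      · exact h'.le
      · exact h'.1.ge
    · exact Multiset.pairwise_sort _ _

theorem exists_represents (π : SetPartition n) : ∃ t : YoungTableau π.shape, t.Represents := by
  classical
  obtain ⟨L, hs, hL, hc⟩ := π.exists_blockList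
  have hlen : (rows π.shape).length = L.length := by rw [← hc, List.length_map]
  let blk : Fin (rows π.shape).length → Finset (Fin n) := fun i => L.get (Fin.cast hlen i)
  have hcard : ∀ i, (blk i).card = (rows π.shape).get i := by
    intro i
    simp [blk, ← hc]
  have hmemL : ∀ B, B ∈ L ↔ B ∈ π.parts := by
    intro B
    rw [← Multiset.mem_coe, hL, Finset.mem_val]
  have hmem : ∀ i, blk i ∈ π.parts := fun i => (hmemL _).1 (List.get_mem _ _)
  have hnd : L.Nodup := by
    rw [← Multiset.coe_nodup, hL]
    exact π.parts.nodup
  have hinj : Function.Injective blk := by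
    intro i j hij
    have := (List.nodup_iff_injective_get.1 hnd) hij
    simpa [Fin.ext_iff] using this
  have hsurj : ∀ B ∈ π.parts, ∃ i, blk i = B := by
    intro B hB
    obtain ⟨k, hk⟩ := List.get_of_mem ((hmemL B).2 hB)
    exact ⟨Fin.cast hlen.symm k, by simpa [blk] using hk⟩
  let f : Box π.shape → Fin n := fun b => (blk b.1).orderEmbOfFin (hcard b.1) b.2
  have hf : ∀ b, f b ∈ blk b.1 := fun b => Finset.orderEmbOfFin_mem _ _ _
  have hbij : Function.Bijective f := by
    constructor
    · rintro ⟨i, a⟩ ⟨j, b⟩ hab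
      have hij : i = j := by
        apply hinj
        refine π.eq_of_mem_parts (hmem i) (hmem j) (hf ⟨i, a⟩) ?_
        rw [hab]
        exact hf ⟨j, b⟩
      subst hij
      have : a = b := ((blk i).orderEmbOfFin (hcard i)).injective hab
      rw [this]
    · intro x
      obtain ⟨i, hi⟩ := hsurj _ (π.part_mem.2 (Finset.mem_univ x))
      have hx : x ∈ Set.range ((blk i).orderEmbOfFin (hcard i)) := by
        rw [Finset.range_orderEmbOfFin, hi]
        exact π.mem_part (Finset.mem_univ x)
      obtain ⟨a, ha⟩ := hx
      exact ⟨⟨i, a⟩, ha⟩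
  have hrow : ∀ i, YoungTableau.rowSet (Equiv.ofBijective f hbij) i = blk i := by
    intro i
    ext x
    rw [← Finset.mem_coe (s := blk i), ← Finset.range_orderEmbOfFin (blk i) (hcard i)]
    simp only [YoungTableau.rowSet, Finset.mem_image, Finset.mem_univ, true_and, Set.mem_range]
    rfl
  refine ⟨Equiv.ofBijective f hbij, ?_, ?_, ?_⟩
  · intro i j k hjk
    exact ((blk i).orderEmbOfFin (hcard i)).strictMono hjk
  · intro i j a b hij hr ha hb
    have hle : blockLE (blk i) (blk j) :=
      List.pairwise_iff_get.1 hs (Fin.cast hlen i) (Fin.cast hlen j) hij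
    have hmin : (blk i).min ≤ (blk j).min := by
      rcases hle with h | h
      · rw [hcard, hcard] at h
        omega
      · exact h.2
    have hposi : 0 < (rows π.shape).get i := rows_pos _ _
    have hposj : 0 < (rows π.shape).get j := rows_pos _ _
    have ea : f ⟨i, a⟩ = (blk i).min' (π.nonempty_of_mem_parts (hmem i)) := by
      have : a = ⟨0, hposi⟩ := Fin.ext ha
      rw [this]
      exact Finset.orderEmbOfFin_zero (hcard i) hposi
    have eb : f ⟨j, b⟩ = (blk j).min' (π.nonempty_of_mem_parts (hmem j)) := by
      have : b = ⟨0, hposj⟩ := Fin.ext hb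
      rw [this]
      exact Finset.orderEmbOfFin_zero (hcard j) hposj
    have hle' : f ⟨i, a⟩ ≤ f ⟨j, b⟩ := by
      rw [ea, eb]
      rw [← Finset.coe_min' (π.nonempty_of_mem_parts (hmem i)),
        ← Finset.coe_min' (π.nonempty_of_mem_parts (hmem j))] at hmin
      exact WithTop.coe_le_coe.1 hmin
    refine lt_of_le_of_ne hle' ?_
    intro h
    have := congrArg Sigma.fst (hbij.1 h)
    exact hij.ne this
  · ext B
    simp only [Finset.mem_image, Finset.mem_univ, true_and, hrow]
    constructor
    · rintro ⟨i, rfl⟩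
      exact hmem i
    · exact hsurj B

/-- The Young tableau of shape `λ(π)` that corresponds to the set partition `π`. -/
def tableau (π : SetPartition n) : YoungTableau π.shape := Classical.choose π.exists_represents

theorem tableau_represents (π : SetPartition n) : π.tableau.Represents :=
  Classical.choose_spec π.exists_represents

/-- The tableau corresponding to `π` is unique. -/
theorem tableau_unique (π : SetPartition n) (t : YoungTableau π.shape) (ht : t.Represents) :
    t = π.tableau := by
  classical
  have key : ∀ t : YoungTableau π.shape, t.Represents →
      (List.ofFn t.rowSet).Pairwise blockLE ∧ (List.ofFn t.rowSet).Perm π.parts.toList := by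
    intro t ht
    have hcard : ∀ i, (t.rowSet i).card = (rows π.shape).get i := by
      intro i
      rw [YoungTableau.rowSet, Finset.card_image_of_injective, Finset.card_univ, Fintype.card_fin]
      intro a b hab
      have := t.injective hab
      simpa using this
    have hinj : Function.Injective t.rowSet := by
      intro i j hij
      have h0 : t ⟨i, ⟨0, rows_pos _ i⟩⟩ ∈ t.rowSet j := by
        rw [← hij]
        exact Finset.mem_image_of_mem _ (Finset.mem_univ _)
      obtain ⟨b, -, hb⟩ := Finset.mem_image.1 h0
      exact (congrArg Sigma.fst (t.injective hb)).symm
    constructor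
    · rw [List.pairwise_ofFn]
      intro i j hij
      have hge : (rows π.shape).get j ≤ (rows π.shape).get i :=
        List.pairwise_iff_get.1 (Multiset.pairwise_sort π.shape.parts (· ≥ ·)) i j hij
      unfold blockLE
      rw [hcard, hcard]
      rcases hge.lt_or_eq with h | h
      · exact Or.inl h
      · refine Or.inr ⟨h.symm, Finset.le_min ?_⟩
        intro x hx
        obtain ⟨b, -, rfl⟩ := Finset.mem_image.1 hx
        have h1 : t ⟨i, ⟨0, rows_pos _ i⟩⟩ < t ⟨j, ⟨0, rows_pos _ j⟩⟩ :=
          ht.first_lt i j _ _ hij h.symm rfl rfl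
        have h2 : t ⟨j, ⟨0, rows_pos _ j⟩⟩ ≤ t ⟨j, b⟩ := by
          rcases Nat.eq_zero_or_pos (b : ℕ) with hb | hb
          · have : b = ⟨0, rows_pos _ j⟩ := Fin.ext hb
            rw [this]
          · exact (ht.row_lt j ⟨0, rows_pos _ j⟩ b hb).le
        refine (Finset.min_le (Finset.mem_image_of_mem _ (Finset.mem_univ
          (⟨0, rows_pos _ i⟩ : Fin ((rows π.shape).get i))))).trans ?_
        exact WithTop.coe_le_coe.2 (h1.le.trans h2)
    · rw [List.perm_ext_iff_of_nodup (List.nodup_ofFn.2 hinj) (Finset.nodup_toList _)]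
      intro B
      rw [Finset.mem_toList, ← ht.image_rowSet]
      simp [List.mem_ofFn]
  obtain ⟨s1, p1⟩ := key t ht
  obtain ⟨s2, p2⟩ := key π.tableau π.tableau_represents
  have hl : List.ofFn t.rowSet = List.ofFn π.tableau.rowSet := by
    refine (p1.trans p2.symm).eq_of_pairwise (le := blockLE) ?_ s1 s2
    intro A B hA hB h₁ h₂
    exact blockLE_antisymm π (Finset.mem_toList.1 (p1.subset hA))
      (Finset.mem_toList.1 (p2.subset hB)) h₁ h₂
  have hrow : t.rowSet = π.tableau.rowSet := List.ofFn_injective hl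
  ext ⟨i, j⟩ : 1
  have hcard : (t.rowSet i).card = (rows π.shape).get i := by
    rw [YoungTableau.rowSet, Finset.card_image_of_injective, Finset.card_univ, Fintype.card_fin]
    intro a b hab
    have := t.injective hab
    simpa using this
  have e1 : (fun j => t ⟨i, j⟩) = (t.rowSet i).orderEmbOfFin hcard :=
    Finset.orderEmbOfFin_unique hcard
      (fun x => Finset.mem_image_of_mem _ (Finset.mem_univ x)) (fun a b hab => ht.row_lt i a b hab)
  have e2 : (fun j => π.tableau ⟨i, j⟩) = (t.rowSet i).orderEmbOfFin hcard :=
    Finset.orderEmbOfFin_unique hcard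
      (fun x => by
        rw [hrow]
        exact Finset.mem_image_of_mem _ (Finset.mem_univ x))
      (fun a b hab => π.tableau_represents.row_lt i a b hab)
  exact congrFun (e1.trans e2.symm) j

/-- The permutation `δ_π`. -/
def delta (π : SetPartition n) : Equiv.Perm (Fin n) := π.tableau.perm

end SetPartition

/-! ### Schur functions -/

/-- The entry `(1 / k!) h_{[k]}` for an integer `k`, where `h_{[0]} = 1` and the entry is `0` for
`k < 0`. Here `[k]` is the set partition of `{1, …, k}` with a single block. -/
def normComplete (k : ℤ) : NCSeries :=
  if 0 ≤ k then ((k.toNat.factorial : ℚ)⁻¹) • (⊤ : SetPartition k.toNat).complete else 0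

/-- The source Schur function `s_{[λ]}`: the noncommutative determinant of the matrix with
entries `(1 / (λ_i - i + j)!) h_{[λ_i - i + j]}`. -/
def sourceSchur {n : ℕ} (lam : n.Partition) : NCSeries :=
  NCSeries.det fun i j : Fin (rows lam).length =>
    normComplete (((rows lam).get i : ℤ) - (i : ℕ) + (j : ℕ))

/-- `s_t = δ_t ∘ s_{[sh(t)]}` for a Young tableau `t`. -/
def tableauSchur {n : ℕ} {lam : n.Partition} (t : YoungTableau lam) : NCSeries :=
  NCSeries.permAct t.perm (sourceSchur lam)

open Classical in
/-- The tabloid function `s_{[t]}`: the sum of `s_{t'}` over all `t'` row equivalent to `t`. -/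
def tabloidSchur {n : ℕ} {lam : n.Partition} (t : YoungTableau lam) : NCSeries :=
  ∑ t' : YoungTableau lam with t.RowEquiv t', tableauSchur t'

/-- The complete homogeneous symmetric function `h_k` in commuting variables (the sum of all
monomials of degree `k`), with `h_0 = 1` and `h_k = 0` for `k < 0`. -/
def commComplete (k : ℤ) : MvPowerSeries ℕ ℚ := fun d => if (d.degree : ℤ) = k then 1 else 0

/-- The Schur function `s_λ`, by the Jacobi-Trudi determinant. -/
def schur {n : ℕ} (lam : n.Partition) : MvPowerSeries ℕ ℚ :=
  Matrix.det (Matrix.of fun i j : Fin (rows lam).length =>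
    commComplete (((rows lam).get i : ℤ) - (i : ℕ) + (j : ℕ)))

end

end NCS

/-!
The tabloid functions are unitriangular over the complete homogeneous functions `h_π`, and these
are a basis because the matrix that expresses them in the `m_σ` is positive definite.

*The `h_π` are independent.* The entry `λ(σ ∧ π)!` counts the permutations that preserve every
block of `σ` and every block of `π` (`IsKernel.partFactorial_shape` and `card_perm_comp_eq`). So
the matrix is the Gram matrix `∑_g v_g v_gᵀ`, with `v_g` the indicator vector of the set partitions
preserved by `g`. A linear relation between the `h_π` is
therefore orthogonal to every `v_g`; taking for `g` a permutation whose cycles are the blocks of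
`ρ`, it is orthogonal to the indicator vector of `{π | ρ ≤ π}` for every `ρ`, and hence is trivial
(`linearIndependent_complete`). By counting dimensions the `h_π` with `π ⊢ [n]` span the same space
as the `m_π`.

*Unitriangularity.* A product of functions `h_[k]` is `h_π` for the set partition `π` of consecutive
intervals (`prod_ofFn_complete_top`). So the determinant `s_[λ]` is a combination of functions
`h_π`, one for each permutation `ε` for which all `λ_i - i + ε(i)` are nonnegative; these numbers
are the block sizes of `π`, where a zero stands for no block. By the
rearrangement inequality the sum of the squares of the block sizes is smallest for `ε = 1`, and only
there (`sum_sq_lt_sum_sq_add_perm`). Permuting places does not change block sizes, and in `s_[t]`,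
for `t` the tableau of `π`, each of the `λ(π)!` terms with `ε = 1` contributes `h_π / λ(π)!`. Thus
`s_[t] - h_π` lies in the span of the `h_σ` with a larger sum of squares
(`tabloidSchur_sub_complete_mem`). A basis in each degree gives a basis of `NCSym`, by homogeneity.

*The commutative image.* `ρ` is a ring homomorphism that ignores permutations of places, and it
sends `h_[k]` to `k! h_k` by counting an orbit of words against the stabilizers
(`rho_complete_top`). Hence it takes `s_[λ]` to the Jacobi-Trudi determinant, and `s_[t]` to `λ!`
times it, as `λ!` is the number of tableaux row equivalent to `t`.
-/

namespace NCS

open Finset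

/-! ### Products of factorials of multiplicities -/

section CountFactorial

variable {β : Type*} [DecidableEq β]

/-- The product of the factorials of the multiplicities of the entries of a list. -/
def countFactorial (l : List β) : ℕ := ∏ b ∈ l.toFinset, (l.count b).factorial

theorem countFactorial_append {l₁ l₂ : List β} (h : l₁.Disjoint l₂) :
    countFactorial (l₁ ++ l₂) = countFactorial l₁ * countFactorial l₂ := by
  unfold countFactorial
  rw [List.toFinset_append, Finset.prod_union]
  · congr 1
    · refine Finset.prod_congr rfl fun b hb => ?_
      rw [List.count_append, List.count_eq_zero_of_not_mem (h (List.mem_toFinset.1 hb)), add_zero]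
    · refine Finset.prod_congr rfl fun b hb => ?_
      rw [List.count_append,
        List.count_eq_zero_of_not_mem fun hb' => h hb' (List.mem_toFinset.1 hb), zero_add]
  · rw [Finset.disjoint_left]
    intro b hb hb'
    exact h (List.mem_toFinset.1 hb) (List.mem_toFinset.1 hb')

theorem count_ofFn {n : ℕ} (f : Fin n → β) (b : β) :
    (List.ofFn f).count b = #{x | f x = b} := by
  rw [List.ofFn_eq_map, ← Multiset.coe_count, ← Multiset.map_coe, Multiset.count_map,
    Finset.card_def, Finset.filter_val]
  simp only [eq_comm]
  rfl

theorem countFactorial_ofFn {n : ℕ} (f : Fin n → β) :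
    countFactorial (List.ofFn f) = ∏ b ∈ univ.image f, (#{x | f x = b}).factorial := by
  unfold countFactorial
  refine Finset.prod_congr ?_ fun b _ => by rw [count_ofFn]
  ext b
  simp [List.mem_ofFn]

/-- The permutations that preserve a function on a finite type permute each of its fibres
separately. -/
theorem card_perm_comp_eq {α : Type*} [Fintype α] [DecidableEq α] (f : α → β) :
    #{g : Equiv.Perm α | f ∘ g = f} = ∏ b ∈ univ.image f, (#{x | f x = b}).factorial := by
  rw [← Fintype.card_subtype, DomMulAct.stabilizer_card']
  simp only [Fintype.card_subtype]

end CountFactorial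

/-! ### Set partitions as kernels of functions -/

namespace SetPartition

variable {n : ℕ} {β γ : Type*}

/-- `π` is the kernel of `f`: its blocks are the nonempty fibres of `f`. -/
def IsKernel (π : SetPartition n) (f : Fin n → β) : Prop :=
  ∀ x y, π.part x = π.part y ↔ f x = f y

theorem isKernel_part (π : SetPartition n) : π.IsKernel π.part := fun _ _ => Iff.rfl

theorem mem_part_iff (π : SetPartition n) {x y : Fin n} : x ∈ π.part y ↔ π.part x = π.part y :=
  π.mem_part_iff_part_eq_part (Finset.mem_univ x) (Finset.mem_univ y)

theorem isKernel_iff_mem_part {π : SetPartition n} {f : Fin n → β} :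
    π.IsKernel f ↔ ∀ x y, x ∈ π.part y ↔ f x = f y :=
  forall_congr' fun _ => forall_congr' fun _ => by rw [mem_part_iff]

theorem exists_isKernel (f : Fin n → β) : ∃ π : SetPartition n, π.IsKernel f := by
  classical
  refine ⟨Finpartition.ofSetoid (Setoid.ker f), isKernel_iff_mem_part.2 fun x y => ?_⟩
  rw [Finpartition.mem_part_ofSetoid_iff_rel]
  exact eq_comm

theorem le_iff_part {π σ : SetPartition n} :
    π ≤ σ ↔ ∀ x y, π.part x = π.part y → σ.part x = σ.part y := by
  constructor
  · intro h x y hxy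
    obtain ⟨C, hC, hle⟩ := h (π.part_mem.2 (Finset.mem_univ y))
    rw [σ.part_eq_of_mem hC (hle (π.mem_part_iff.2 hxy)),
      σ.part_eq_of_mem hC (hle (π.mem_part_iff.2 rfl))]
  · intro h B hB
    obtain ⟨x, hx⟩ := π.nonempty_of_mem_parts hB
    refine ⟨σ.part x, σ.part_mem.2 (Finset.mem_univ x), fun y hy => ?_⟩
    rw [← π.part_eq_of_mem hB hx] at hy
    exact σ.mem_part_iff.2 (h _ _ (π.mem_part_iff.1 hy))

theorem IsKernel.unique {π σ : SetPartition n} {f : Fin n → β} (h : π.IsKernel f)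
    (h' : σ.IsKernel f) : π = σ :=
  le_antisymm (le_iff_part.2 fun x y => by rw [h x y, h' x y]; exact id)
    (le_iff_part.2 fun x y => by rw [h x y, h' x y]; exact id)

theorem part_inf (π σ : SetPartition n) (x : Fin n) : (π ⊓ σ).part x = π.part x ∩ σ.part x := by
  refine (π ⊓ σ).part_eq_of_mem ?_
    (Finset.mem_inter.2 ⟨π.mem_part (Finset.mem_univ x), σ.mem_part (Finset.mem_univ x)⟩)
  rw [Finpartition.parts_inf, Finset.mem_erase, Finset.mem_image]
  refine ⟨?_, ⟨π.part x, σ.part x⟩, Finset.mem_product.2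
    ⟨π.part_mem.2 (Finset.mem_univ x), σ.part_mem.2 (Finset.mem_univ x)⟩, rfl⟩
  exact Finset.ne_empty_of_mem
    (Finset.mem_inter.2 ⟨π.mem_part (Finset.mem_univ x), σ.mem_part (Finset.mem_univ x)⟩)

theorem IsKernel.inf {π σ : SetPartition n} {f : Fin n → β} {g : Fin n → γ} (hf : π.IsKernel f)
    (hg : σ.IsKernel g) : (π ⊓ σ).IsKernel fun x => (f x, g x) := by
  rw [isKernel_iff_mem_part] at hf hg ⊢
  intro x y
  rw [part_inf, Finset.mem_inter, hf, hg, Prod.mk.injEq]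

theorem IsKernel.perm {π : SetPartition n} {f : Fin n → β} (h : π.IsKernel f)
    (δ : Equiv.Perm (Fin n)) : (SetPartition.perm δ π).IsKernel (f ∘ δ.symm) := by
  intro x y
  have e := h (δ.symm x) (δ.symm y)
  rw [Function.comp_apply, Function.comp_apply, ← e, ← δ.apply_symm_apply x,
    ← δ.apply_symm_apply y, part_perm, part_perm, Finset.map_inj]
  simp

theorem isKernel_top (f : Fin n → β) (hf : ∀ x y, f x = f y) :
    (⊤ : SetPartition n).IsKernel f := by
  obtain ⟨π, hπ⟩ := exists_isKernel f
  have : π = ⊤ := top_le_iff.1 (le_iff_part.2 fun x y _ => (hπ x y).2 (hf x y))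
  exact this ▸ hπ

theorem IsKernel.part_eq [DecidableEq β] {π : SetPartition n} {f : Fin n → β} (h : π.IsKernel f)
    (x : Fin n) : π.part x = ({y | f y = f x} : Finset (Fin n)) := by
  ext y
  rw [mem_part_iff, h y x]
  simp

theorem IsKernel.partFactorial_shape [DecidableEq β] {π : SetPartition n} {f : Fin n → β}
    (h : π.IsKernel f) :
    partFactorial π.shape = ∏ b ∈ univ.image f, (#{x | f x = b}).factorial := by
  change ((π.parts.val.map Finset.card).map Nat.factorial).prod = _
  rw [Multiset.map_map]
  change ∏ B ∈ π.parts, (#B).factorial = _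
  symm
  refine Finset.prod_bij (fun b _ => ({x | f x = b} : Finset (Fin n))) ?_ ?_ ?_ fun _ _ => rfl
  · intro b hb
    obtain ⟨x, -, rfl⟩ := Finset.mem_image.1 hb
    rw [← h.part_eq]
    exact π.part_mem.2 (Finset.mem_univ x)
  · intro b hb c hc hbc
    obtain ⟨x, -, rfl⟩ := Finset.mem_image.1 hb
    have hx : x ∈ ({y | f y = f x} : Finset (Fin n)) := by simp
    rw [hbc] at hx
    simpa using hx
  · intro B hB
    obtain ⟨x, hx⟩ := π.nonempty_of_mem_parts hB
    exact ⟨f x, Finset.mem_image_of_mem _ (Finset.mem_univ x),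
      by rw [← h.part_eq, π.part_eq_of_mem hB hx]⟩

end SetPartition

/-! ### The coefficients of the functions `h_π` -/

section LabelComplete

variable {β : Type*} [DecidableEq β]

/-- The function `h_π` of the set partition `π` whose blocks are the sets of positions of equal
entries in the list of labels `L`. A word `w` as long as `L` occurs in it with the product of
`#{x : L_x = b, w_x = i}!` over all `b` and `i`. Lists make this compatible with concatenation. -/
def labelComplete (L : List β) : NCSeries where
  coeff w := if L.length = w.length then (countFactorial (L.zip w) : ℚ) else 0

theorem labelComplete_nil : labelComplete ([] : List β) = 1 := by
  ext w
  cases w <;> simp [labelComplete, NCSeries.coeff_one, countFactorial]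

theorem labelComplete_append {L₁ L₂ : List β} (h : L₁.Disjoint L₂) :
    labelComplete (L₁ ++ L₂) = labelComplete L₁ * labelComplete L₂ := by
  ext w
  rw [NCSeries.coeff_mul]
  by_cases hw : (L₁ ++ L₂).length = w.length
  · rw [List.length_append] at hw
    rw [Finset.sum_eq_single (L₁.length, L₂.length)]
    · have e : (L₁ ++ L₂).zip w =
          L₁.zip (w.take L₁.length) ++ L₂.zip (w.drop L₁.length) := by
        conv_lhs => rw [← List.take_append_drop L₁.length w]
        rw [List.zip_append]
        simp; omega
      have hd : (L₁.zip (w.take L₁.length)).Disjoint (L₂.zip (w.drop L₁.length)) := by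
        rintro ⟨b, i⟩ h₁ h₂
        exact h (List.of_mem_zip h₁).1 (List.of_mem_zip h₂).1
      have hl₁ : L₁.length = (w.take L₁.length).length := by simp; omega
      have hl₂ : L₂.length = (w.drop L₁.length).length := by simp; omega
      simp only [labelComplete, List.length_append]
      rw [if_pos hw, if_pos hl₁, if_pos hl₂, e, countFactorial_append hd, Nat.cast_mul]
    · rintro ⟨i, j⟩ hij hne
      rw [Finset.HasAntidiagonal.mem_antidiagonal] at hij
      have : L₁.length ≠ (w.take i).length := by
        rw [List.length_take]
        intro hi
        apply hne
        simp only at hij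
        ext <;> simp <;> omega
      simp only [labelComplete]
      rw [if_neg this, zero_mul]
    · intro h
      exact absurd (Finset.HasAntidiagonal.mem_antidiagonal.2 hw) h
  · rw [Finset.sum_eq_zero]
    · simp only [labelComplete]
      rw [if_neg hw]
    · rintro ⟨i, j⟩ hij
      rw [Finset.HasAntidiagonal.mem_antidiagonal] at hij
      simp only at hij
      rw [List.length_append] at hw
      simp only [labelComplete, List.length_take, List.length_drop]
      by_cases h₁ : L₁.length = min i w.length
      · rw [if_neg (c := L₂.length = _) (by omega), mul_zero]
      · rw [if_neg h₁, zero_mul]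

theorem prod_labelComplete (Ls : List (List β)) (h : Ls.Pairwise List.Disjoint) :
    (Ls.map labelComplete).prod = labelComplete Ls.flatten := by
  induction Ls with
  | nil => exact labelComplete_nil.symm
  | cons L Ls ih =>
    rw [List.pairwise_cons] at h
    rw [List.map_cons, List.prod_cons, ih h.2, List.flatten_cons, labelComplete_append]
    intro b hb hb'
    obtain ⟨L', hL', hb''⟩ := List.mem_flatten.1 hb'
    exact h.1 L' hL' hb hb''

end LabelComplete

namespace SetPartition

variable {n : ℕ} {β : Type*}

theorem complete_coeff_of_length_ne (π : SetPartition n) {w : List ℕ} (h : w.length ≠ n) :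
    π.complete.coeff w = 0 := by
  rw [complete, NCSeries.coeff_sum]
  refine Finset.sum_eq_zero fun σ _ => ?_
  rw [NCSeries.coeff_smul]
  simp [monomial, h]

theorem monomial_coeff_ofFn (σ : SetPartition n) (u : Fin n → ℕ) [Decidable (σ.IsKernel u)] :
    σ.monomial.coeff (List.ofFn u) = if σ.IsKernel u then 1 else 0 := by
  simp only [monomial]
  refine if_congr ?_ rfl rfl
  simp only [List.length_ofFn, exists_true_left, IsKernel]
  refine forall_congr' fun x => forall_congr' fun y => ?_
  simp [iff_comm]

theorem IsKernel.monomial_coeff {σ : SetPartition n} {u : Fin n → ℕ} (h : σ.IsKernel u)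
    (π : SetPartition n) [Decidable (π = σ)] :
    π.monomial.coeff (List.ofFn u) = if π = σ then 1 else 0 := by
  classical
  rw [monomial_coeff_ofFn]
  refine if_congr ⟨fun h' => h'.unique h, ?_⟩ rfl rfl
  rintro rfl
  exact h

theorem IsKernel.complete_coeff {σ : SetPartition n} {u : Fin n → ℕ} (h : σ.IsKernel u)
    (π : SetPartition n) :
    π.complete.coeff (List.ofFn u) = partFactorial (shape (σ ⊓ π)) := by
  classical
  simp [complete, NCSeries.coeff_sum, NCSeries.coeff_smul, h.monomial_coeff]

theorem IsKernel.complete_eq [DecidableEq β] {π : SetPartition n} {f : Fin n → β}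
    (h : π.IsKernel f) : π.complete = labelComplete (List.ofFn f) := by
  ext w
  by_cases hw : w.length = n
  · subst hw
    obtain ⟨σ, hσ⟩ := exists_isKernel (n := w.length) w.get
    have e : π.complete.coeff w = π.complete.coeff (List.ofFn w.get) := by rw [List.ofFn_get]
    have ez : (List.ofFn f).zip w = List.ofFn fun x => (f x, w.get x) := by
      refine List.ext_getElem (by simp) fun i h₁ h₂ => ?_
      simp
    rw [e, hσ.complete_coeff, inf_comm, (h.inf hσ).partFactorial_shape, labelComplete]
    simp only [List.length_ofFn, if_true]
    rw [ez, countFactorial_ofFn]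
  · rw [complete_coeff_of_length_ne _ hw]
    simp [labelComplete, Ne.symm hw]

theorem complete_top_eq (k : ℕ) [DecidableEq β] (b : β) :
    (⊤ : SetPartition k).complete = labelComplete (List.replicate k b) := by
  rw [(isKernel_top (fun _ : Fin k => b) fun _ _ => rfl).complete_eq, List.ofFn_const]

end SetPartition

/-! ### Linear independence of the `m_π` and of the `h_π` -/

namespace SetPartition

variable {n : ℕ}

theorem exists_word_isKernel (σ : SetPartition n) : ∃ u : Fin n → ℕ, σ.IsKernel u :=
  ⟨fun x => Encodable.encode (σ.part x), fun _ _ => Encodable.encode_inj.symm⟩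

theorem linearIndependent_monomial :
    LinearIndependent ℚ (fun π : SetPartition n => π.monomial) := by
  classical
  rw [Fintype.linearIndependent_iff]
  intro a ha σ
  obtain ⟨u, hu⟩ := σ.exists_word_isKernel
  have h := congrArg (fun f => f.coeff (List.ofFn u)) ha
  simpa [NCSeries.coeff_sum, NCSeries.coeff_smul, NCSeries.coeff_zero, hu.monomial_coeff] using h

/-- A permutation whose cycles are the blocks of `ρ` preserves the blocks of exactly those set
partitions that are coarser than `ρ`. -/
theorem exists_perm_comp_part_eq_iff (ρ : SetPartition n) :
    ∃ g : Equiv.Perm (Fin n), ∀ π : SetPartition n, π.part ∘ g = π.part ↔ ρ ≤ π := by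
  classical
  have hc : ∀ B : Finset (Fin n), ∃ c : Equiv.Perm {x // ρ.part x = B},
      c.IsCycleOn (Finset.univ : Finset {x // ρ.part x = B}) := fun B =>
    (Finset.exists_cycleOn Finset.univ).imp fun _ h => h.1
  choose c hc using hc
  refine ⟨(Equiv.sigmaFiberEquiv ρ.part).symm.trans
    ((Equiv.sigmaCongrRight c).trans (Equiv.sigmaFiberEquiv ρ.part)), fun π => ?_⟩
  have key : ∀ x, ((Equiv.sigmaFiberEquiv ρ.part).symm.trans
    ((Equiv.sigmaCongrRight c).trans (Equiv.sigmaFiberEquiv ρ.part))) x =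
      c (ρ.part x) ⟨x, rfl⟩ := fun x => rfl
  constructor
  · intro h
    have hstep : ∀ (B : Finset (Fin n)) (z : {x // ρ.part x = B}),
        π.part (c B z : Fin n) = π.part z := by
      rintro B ⟨x, rfl⟩
      have := congrFun h x
      rwa [Function.comp_apply, key] at this
    have hpow : ∀ (B : Finset (Fin n)) (z : {x // ρ.part x = B}) (k : ℕ),
        π.part ((c B ^ k) z : Fin n) = π.part z := by
      intro B z k
      induction k with
      | zero => rfl
      | succ k ih => rw [pow_succ', Equiv.Perm.mul_apply, hstep, ih]
    refine le_iff_part.2 fun x y hxy => ?_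
    obtain ⟨k, -, hk⟩ := (hc (ρ.part y)).exists_pow_eq (a := ⟨x, hxy⟩) (b := ⟨y, rfl⟩)
      (Finset.mem_univ _) (Finset.mem_univ _)
    rw [← hpow (ρ.part y) ⟨x, hxy⟩ k, hk]
  · intro h
    funext x
    refine le_iff_part.1 h _ _ ?_
    rw [key]
    exact (c (ρ.part x) ⟨x, rfl⟩).2

/-- The matrix `λ(σ ∧ π)!` is a Gram matrix: it equals `∑ v_g v_gᵀ`, where `v_g` is the indicator
vector of the set partitions all of whose blocks are preserved by the permutation `g`. So a linear
relation between the `h_π` is orthogonal to all `v_g`, in particular to the indicator vectors of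
the upper sets `{π | ρ ≤ π}`, and these span. -/
theorem linearIndependent_complete :
    LinearIndependent ℚ (fun π : SetPartition n => π.complete) := by
  classical
  rw [Fintype.linearIndependent_iff]
  intro a ha
  have h₁ : ∀ σ : SetPartition n, ∑ π, a π * (partFactorial (shape (σ ⊓ π)) : ℚ) = 0 := by
    intro σ
    obtain ⟨u, hu⟩ := σ.exists_word_isKernel
    have h := congrArg (fun f => f.coeff (List.ofFn u)) ha
    simpa [NCSeries.coeff_sum, NCSeries.coeff_smul, NCSeries.coeff_zero, hu.complete_coeff] using h
  have h₂ : ∀ σ π : SetPartition n, (partFactorial (shape (σ ⊓ π)) : ℚ) =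
      ∑ g : Equiv.Perm (Fin n), (if σ.part ∘ g = σ.part then 1 else 0) *
        (if π.part ∘ g = π.part then 1 else 0) := by
    intro σ π
    have hk := σ.isKernel_part.inf π.isKernel_part
    rw [hk.partFactorial_shape, ← card_perm_comp_eq, Finset.card_filter, Nat.cast_sum]
    refine Finset.sum_congr rfl fun g _ => ?_
    rw [ite_zero_mul_ite_zero, mul_one, Nat.cast_ite, Nat.cast_one, Nat.cast_zero]
    refine if_congr ?_ rfl rfl
    simp [funext_iff, forall_and]
  have h₃ : ∑ g : Equiv.Perm (Fin n),
      (∑ π : SetPartition n, a π * (if π.part ∘ g = π.part then 1 else 0)) ^ 2 = 0 := by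
    calc _ = ∑ σ, a σ * ∑ π, a π * (partFactorial (shape (σ ⊓ π)) : ℚ) := by
          simp only [h₂, sq, Finset.mul_sum]
          rw [Finset.sum_comm]
          refine Finset.sum_congr rfl fun σ _ => ?_
          rw [Finset.sum_comm]
          refine Finset.sum_congr rfl fun g _ => ?_
          rw [Finset.sum_mul]
          refine Finset.sum_congr rfl fun π _ => ?_
          ring
      _ = 0 := by simp [h₁]
  have h₄ : ∀ ρ : SetPartition n, ∑ π with ρ ≤ π, a π = 0 := by
    intro ρ
    obtain ⟨g, hg⟩ := ρ.exists_perm_comp_part_eq_iff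
    have := (Finset.sum_eq_zero_iff_of_nonneg fun g _ => sq_nonneg _).1 h₃ g (Finset.mem_univ g)
    rw [sq_eq_zero_iff] at this
    simpa [hg, Finset.sum_filter] using this
  intro ρ
  induction ρ using (wellFounded_gt (α := SetPartition n)).induction with
  | _ ρ ih =>
    have h := h₄ ρ
    rwa [Finset.sum_eq_single_of_mem ρ (by simp)] at h
    intro π hπ hne
    exact ih π (lt_of_le_of_ne (by simpa using hπ) hne.symm)

theorem span_complete_eq_span_monomial :
    Submodule.span ℚ (Set.range fun π : SetPartition n => π.complete) =
      Submodule.span ℚ (Set.range fun π : SetPartition n => π.monomial) := by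
  have : FiniteDimensional ℚ
      (Submodule.span ℚ (Set.range fun π : SetPartition n => π.monomial)) :=
    FiniteDimensional.span_of_finite ℚ (Set.finite_range _)
  refine Submodule.eq_of_le_of_finrank_eq ?_ ?_
  · rw [Submodule.span_le]
    rintro _ ⟨π, rfl⟩
    exact Submodule.sum_mem _ fun σ _ =>
      Submodule.smul_mem _ _ (Submodule.subset_span ⟨σ, rfl⟩)
  · rw [finrank_span_eq_card linearIndependent_complete,
      finrank_span_eq_card linearIndependent_monomial]

end SetPartition

/-! ### Unitriangular families -/

/-- A family that is unitriangular with respect to `v`, for the order given by a statistic `q`,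
has the same span as `v`, and is linearly independent if `v` is. -/
theorem linearIndependent_of_unitriangular {K ι V : Type*} [Field K] [Fintype ι] [AddCommGroup V]
    [Module K V] {v w : ι → V} (q : ι → ℕ) (hv : LinearIndependent K v)
    (h : ∀ i, w i - v i ∈ Submodule.span K (v '' {j | q i < q j})) :
    LinearIndependent K w ∧ Submodule.span K (Set.range w) = Submodule.span K (Set.range v) := by
  have hle : Submodule.span K (Set.range w) ≤ Submodule.span K (Set.range v) := by
    rw [Submodule.span_le]
    rintro _ ⟨i, rfl⟩
    rw [← sub_add_cancel (w i) (v i)]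
    exact Submodule.add_mem _ (Submodule.span_mono (Set.image_subset_range _ _) (h i))
      (Submodule.subset_span ⟨i, rfl⟩)
  obtain ⟨N, hN⟩ : ∃ N, ∀ i, q i ≤ N := ⟨∑ i, q i, fun i =>
    Finset.single_le_sum (fun _ _ => Nat.zero_le _) (Finset.mem_univ i)⟩
  have hge : ∀ (k : ℕ) (i : ι), N - q i = k → v i ∈ Submodule.span K (Set.range w) := by
    intro k
    induction k using Nat.strong_induction_on with
    | _ k ih =>
      intro i hi
      rw [← sub_sub_cancel (w i) (v i)]
      refine Submodule.sub_mem _ (Submodule.subset_span ⟨i, rfl⟩) ?_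
      refine Submodule.span_le.2 ?_ (h i)
      rintro _ ⟨j, hj, rfl⟩
      have h₁ : q i < q j := hj
      have h₂ := hN j
      exact ih (N - q j) (by omega) j rfl
  have heq : Submodule.span K (Set.range w) = Submodule.span K (Set.range v) := by
    refine le_antisymm hle (Submodule.span_le.2 ?_)
    rintro _ ⟨i, rfl⟩
    exact hge _ i rfl
  refine ⟨linearIndependent_iff_card_eq_finrank_span.2 ?_, heq⟩
  rw [Set.finrank, heq, finrank_span_eq_card hv]

/-! ### Expansion of the source Schur functions in the `h_π` -/

namespace SetPartition

variable {n : ℕ}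

/-- The sum of the squares of the block sizes, as the number of pairs of elements lying in a
common block. -/
def pairCount (π : SetPartition n) : ℕ := #{p : Fin n × Fin n | π.part p.1 = π.part p.2}

theorem IsKernel.pairCount_eq {β : Type*} [Fintype β] [DecidableEq β] {π : SetPartition n}
    {f : Fin n → β} (h : π.IsKernel f) :
    π.pairCount = ∑ b, #{x | f x = b} ^ 2 := by
  have e : (Finset.univ.filter fun p : Fin n × Fin n => π.part p.1 = π.part p.2) =
      Finset.univ.filter fun p : Fin n × Fin n => f p.1 = f p.2 :=
    Finset.filter_congr fun p _ => h p.1 p.2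
  rw [pairCount, e, Finset.card_eq_sum_card_fiberwise (f := fun p => f p.1) (t := Finset.univ)
    fun _ _ => Finset.mem_coe.2 (Finset.mem_univ _)]
  refine Finset.sum_congr rfl fun b _ => ?_
  rw [sq, ← Finset.card_product]
  congr 1
  ext ⟨x, y⟩
  simp only [Finset.mem_filter, Finset.mem_univ, true_and, Finset.mem_product]
  constructor
  · rintro ⟨h₁, h₂⟩
    exact ⟨h₂, h₁ ▸ h₂⟩
  · rintro ⟨h₁, h₂⟩
    exact ⟨h₁.trans h₂.symm, h₁⟩

theorem pairCount_perm (δ : Equiv.Perm (Fin n)) (π : SetPartition n) :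
    (perm δ π).pairCount = π.pairCount := by
  unfold pairCount
  symm
  refine Finset.card_equiv (δ.prodCongr δ) fun p => ?_
  simp [part_perm, Finset.map_inj]

theorem permAct_mem_span (δ : Equiv.Perm (Fin n)) (N : ℕ) {f : NCSeries}
    (hf : f ∈ Submodule.span ℚ (complete '' {σ : SetPartition n | N < σ.pairCount})) :
    NCSeries.permAct δ f ∈
      Submodule.span ℚ (complete '' {σ : SetPartition n | N < σ.pairCount}) := by
  have h := Submodule.mem_map_of_mem (f := NCSeries.permAct δ) hf
  rw [Submodule.map_span] at h
  refine Submodule.span_mono ?_ h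
  rintro _ ⟨_, ⟨σ, hσ, rfl⟩, rfl⟩
  rw [permAct_complete]
  exact ⟨_, by simpa [pairCount_perm] using hσ, rfl⟩

end SetPartition

theorem getElem?_flatten {β : Type*} (Ls : List (List β)) (i j : ℕ) (hi : i < Ls.length)
    (hj : j < Ls[i].length) :
    Ls.flatten[((Ls.map List.length).take i).sum + j]? = some Ls[i][j] := by
  induction Ls generalizing i with
  | nil => simp at hi
  | cons L Ls ih =>
    cases i with
    | zero =>
      simp only [List.getElem_cons_zero] at hj
      simp [List.getElem?_append_left hj]
    | succ i =>
      simp only [List.map_cons, List.take_succ_cons, List.sum_cons, List.flatten_cons,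
        List.getElem_cons_succ]
      rw [List.getElem?_append_right (by omega)]
      rw [← ih i (by simpa using hi) (by simpa using hj)]
      congr 1
      omega

/-- Reading the boxes of a diagram with row lengths `α` row by row, the row indices met are
`0, …, 0, 1, …, 1, …`. -/
theorem flatten_replicate_eq_ofFn {k n : ℕ} (α : Fin k → ℕ) (h : ∑ i, α i = n) :
    (List.ofFn fun i => List.replicate (α i) i).flatten =
      List.ofFn fun x : Fin n => ((finSigmaFinEquiv.trans (finCongr h)).symm x).1 := by
  subst h
  have hlen : (List.ofFn fun i => List.replicate (α i) i).map List.length = List.ofFn α := by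
    rw [List.map_ofFn]
    congr 1
    funext i
    simp
  refine List.ext_getElem? fun x => ?_
  by_cases hx : x < ∑ i, α i
  · obtain ⟨⟨i, j⟩, hij⟩ := finSigmaFinEquiv.surjective (⟨x, hx⟩ : Fin (∑ i, α i))
    have hx' : x = ((List.ofFn α).take i).sum + j := by
      have e := congrArg Fin.val hij
      rw [finSigmaFinEquiv_apply] at e
      simp only at e
      rw [← e, ← List.sum_ofFn]
      congr 2
      refine List.ext_getElem ?_ fun a h₁ h₂ => ?_
      · simp [i.2.le]
      · simp
    have h₁ := getElem?_flatten (List.ofFn fun i => List.replicate (α i) i) i j (by simp)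
      (by simp)
    rw [hlen, ← hx'] at h₁
    rw [h₁, List.getElem?_ofFn, dif_pos hx]
    simp [← hij]
  · rw [List.getElem?_eq_none, List.getElem?_eq_none]
    · simpa using hx
    · rw [List.length_flatten, hlen, List.sum_ofFn]
      simpa using hx

theorem card_finSigma_fst {k n : ℕ} (α : Fin k → ℕ) (e : (Σ i, Fin (α i)) ≃ Fin n) (i : Fin k) :
    #{x | (e.symm x).1 = i} = α i := by
  rw [← Fintype.card_fin (α i), ← Finset.card_univ]
  symm
  refine Finset.card_bij (fun j _ => e ⟨i, j⟩) ?_ ?_ ?_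
  · intro j _
    simp
  · intro j _ j' _ hjj'
    simpa using hjj'
  · intro x hx
    obtain ⟨⟨i', j⟩, rfl⟩ := e.surjective x
    obtain rfl : i' = i := by simpa using hx
    exact ⟨j, Finset.mem_univ _, rfl⟩

namespace NCSeries

instance : IsScalarTower ℚ NCSeries NCSeries where
  smul_assoc c f g := by
    ext w
    simp [coeff_mul, coeff_smul, Finset.mul_sum, mul_assoc]

instance : SMulCommClass ℚ NCSeries NCSeries where
  smul_comm c f g := by
    ext w
    simp [coeff_mul, coeff_smul, Finset.mul_sum, mul_left_comm]

theorem prod_ofFn_smul {k : ℕ} (c : Fin k → ℚ) (f : Fin k → NCSeries) :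
    (List.ofFn fun i => c i • f i).prod = (∏ i, c i) • (List.ofFn f).prod := by
  induction k with
  | zero => simp
  | succ k ih =>
    rw [List.ofFn_succ, List.ofFn_succ, List.prod_cons, List.prod_cons, ih, Fin.prod_univ_succ,
      smul_mul_smul_comm]

end NCSeries

theorem prod_ofFn_complete_top {k n : ℕ} (α : Fin k → ℕ) (h : ∑ i, α i = n) {π : SetPartition n}
    (hπ : π.IsKernel fun x => ((finSigmaFinEquiv.trans (finCongr h)).symm x).1) :
    (List.ofFn fun i => (⊤ : SetPartition (α i)).complete).prod = π.complete := by
  rw [hπ.complete_eq, ← flatten_replicate_eq_ofFn, ← prod_labelComplete, List.map_ofFn]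
  · congr 2
    funext i
    exact SetPartition.complete_top_eq (α i) i
  · rw [List.pairwise_ofFn]
    intro i j hij b hi hj
    exact hij.ne ((List.eq_of_mem_replicate hi).symm.trans (List.eq_of_mem_replicate hj))

theorem prod_ofFn_normComplete {k n : ℕ} (α : Fin k → ℕ) (h : ∑ i, α i = n) {π : SetPartition n}
    (hπ : π.IsKernel fun x => ((finSigmaFinEquiv.trans (finCongr h)).symm x).1) :
    (List.ofFn fun i => normComplete (α i)).prod =
      (∏ i, ((α i).factorial : ℚ)⁻¹) • π.complete := by
  rw [← prod_ofFn_complete_top α h hπ, ← NCSeries.prod_ofFn_smul]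
  exact congrArg (fun f => (List.ofFn f).prod) (funext fun i => by simp [normComplete])

/-- By the rearrangement inequality, adding `ε - id` to a weakly decreasing sequence increases the
sum of its squares. -/
theorem sum_sq_lt_sum_sq_add_perm {k : ℕ} {a : Fin k → ℤ} (ha : Antitone a)
    {ε : Equiv.Perm (Fin k)} (hε : ε ≠ 1) :
    ∑ i, a i ^ 2 < ∑ i, (a i - (i : ℕ) + (ε i : ℕ)) ^ 2 := by
  have hanti : Antivary a fun i : Fin k => ((i : ℕ) : ℤ) := by
    intro i j hij
    exact ha (by simpa using hij.le)
  have h₁ := hanti.sum_mul_le_sum_mul_comp_perm (σ := ε)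
  have h₂ : 0 < ∑ i, (((ε i : ℕ) : ℤ) - (i : ℕ)) ^ 2 := by
    obtain ⟨i, hi⟩ : ∃ i, ε i ≠ i := by
      by_contra! h
      exact hε (Equiv.ext h)
    refine Finset.sum_pos' (fun _ _ => sq_nonneg _) ⟨i, Finset.mem_univ i, ?_⟩
    have : ((ε i : ℕ) : ℤ) - (i : ℕ) ≠ 0 := by
      rw [sub_ne_zero]
      simpa [Fin.ext_iff] using hi
    positivity
  have h₃ : ∑ i, (a i - (i : ℕ) + (ε i : ℕ)) ^ 2 = ∑ i, a i ^ 2 +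
      2 * (∑ i, a i * (ε i : ℕ) - ∑ i, a i * (i : ℕ)) +
        ∑ i, (((ε i : ℕ) : ℤ) - (i : ℕ)) ^ 2 := by
    rw [← Finset.sum_sub_distrib, Finset.mul_sum, ← Finset.sum_add_distrib,
      ← Finset.sum_add_distrib]
    exact Finset.sum_congr rfl fun i _ => by ring
  linarith

theorem sum_get_rows {n : ℕ} (lam : n.Partition) : ∑ i, (rows lam).get i = n := by
  rw [← List.sum_ofFn, List.ofFn_get, sum_rows]

theorem antitone_get_rows {n : ℕ} (lam : n.Partition) :
    Antitone fun i => (((rows lam).get i : ℕ) : ℤ) := by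
  intro i j hij
  rcases hij.eq_or_lt with rfl | h
  · exact le_rfl
  · exact Int.ofNat_le.2
      (List.pairwise_iff_get.1 (Multiset.pairwise_sort lam.parts (· ≥ ·)) i j h)

theorem partFactorial_eq_prod {n : ℕ} (lam : n.Partition) :
    partFactorial lam = ∏ i, ((rows lam).get i).factorial := by
  have h : partFactorial lam = ((rows lam).map Nat.factorial).prod := by
    rw [partFactorial, ← Multiset.prod_coe, ← Multiset.map_coe, rows, Multiset.sort_eq]
  rw [h, ← List.prod_ofFn]
  congr 1
  exact List.ext_getElem (by simp) fun i h₁ h₂ => by simp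

/-- The term of the identity permutation in the determinant `s_[λ]` is a multiple of `h_κ`, where
the blocks of `κ` are the rows of the diagram of `λ` in the reading order; in all other terms the
blocks have a larger sum of squares. -/
theorem sourceSchur_sub_mem {n : ℕ} (lam : n.Partition) {κ : SetPartition n}
    (hκ : κ.IsKernel fun x => ((readingOrder lam).symm x).1) :
    sourceSchur lam - (partFactorial lam : ℚ)⁻¹ • κ.complete ∈ Submodule.span ℚ
      (SetPartition.complete '' {σ : SetPartition n | κ.pairCount < σ.pairCount}) := by
  have hκc : (κ.pairCount : ℤ) = ∑ i, (((rows lam).get i : ℕ) : ℤ) ^ 2 := by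
    rw [hκ.pairCount_eq]
    push_cast
    exact Finset.sum_congr rfl fun i _ => by rw [card_finSigma_fst]
  rw [sourceSchur, NCSeries.det, ← Finset.add_sum_erase _ _ (Finset.mem_univ 1)]
  have h₁ : ((Equiv.Perm.sign (1 : Equiv.Perm (Fin (rows lam).length)) : ℤˣ) : ℤ) •
      (List.ofFn fun i => normComplete (((rows lam).get i : ℤ) - (i : ℕ) +
        (((1 : Equiv.Perm (Fin (rows lam).length)) i : Fin _) : ℕ))).prod =
      (partFactorial lam : ℚ)⁻¹ • κ.complete := by
    rw [partFactorial_eq_prod, Nat.cast_prod, ← Finset.prod_inv_distrib,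
      ← prod_ofFn_normComplete _ (sum_get_rows lam) hκ]
    simp
  rw [h₁, add_sub_cancel_left]
  refine Submodule.sum_mem _ fun ε hε => zsmul_mem ?_ _
  have hε : ε ≠ 1 := by simpa using hε
  by_cases hneg : ∃ i, ((rows lam).get i : ℤ) - (i : ℕ) + (ε i : ℕ) < 0
  · obtain ⟨i, hi⟩ := hneg
    rw [List.prod_eq_zero]
    · exact Submodule.zero_mem _
    · rw [List.mem_ofFn]
      exact ⟨i, by rw [normComplete, if_neg (by omega)]⟩
  · push Not at hneg
    obtain ⟨α, hα⟩ : ∃ α : Fin (rows lam).length → ℕ, ∀ i,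
        ((rows lam).get i : ℤ) - (i : ℕ) + (ε i : ℕ) = α i :=
      ⟨_, fun i => (Int.toNat_of_nonneg (hneg i)).symm⟩
    have hsum : ∑ i, α i = n := by
      zify
      simp only [← hα]
      rw [Finset.sum_add_distrib, Finset.sum_sub_distrib,
        Equiv.sum_comp ε fun i => ((i : ℕ) : ℤ), sub_add_cancel]
      exact_mod_cast sum_get_rows lam
    obtain ⟨π, hπ⟩ := SetPartition.exists_isKernel fun x : Fin n =>
      ((finSigmaFinEquiv.trans (finCongr hsum)).symm x).1
    simp only [hα]
    rw [prod_ofFn_normComplete α hsum hπ]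
    refine Submodule.smul_mem _ _ (Submodule.subset_span ⟨π, ?_, rfl⟩)
    have hlt := sum_sq_lt_sum_sq_add_perm (antitone_get_rows lam) hε
    rw [← hκc] at hlt
    simp only [hα] at hlt
    change κ.pairCount < π.pairCount
    rw [hπ.pairCount_eq]
    simp only [card_finSigma_fst]
    exact_mod_cast hlt

/-! ### Tabloid functions -/

namespace YoungTableau

variable {n : ℕ} {lam : n.Partition}

theorem mem_rowSet (t : YoungTableau lam) (i : Fin (rows lam).length) (x : Fin n) :
    x ∈ t.rowSet i ↔ (t.symm x).1 = i := by
  simp only [rowSet, Finset.mem_image, Finset.mem_univ, true_and]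
  constructor
  · rintro ⟨j, rfl⟩
    simp
  · rintro rfl
    exact ⟨(t.symm x).2, t.apply_symm_apply x⟩

theorem rowEquiv_iff {t t' : YoungTableau lam} :
    t.RowEquiv t' ↔ ∀ x, (t.symm x).1 = (t'.symm x).1 := by
  constructor
  · intro h x
    have h' := (mem_rowSet t _ x).2 rfl
    rw [h, mem_rowSet] at h'
    exact h'.symm
  · intro h i
    ext x
    rw [mem_rowSet, mem_rowSet, h]

theorem Represents.isKernel {π : SetPartition n} {t : YoungTableau π.shape} (ht : t.Represents) :
    π.IsKernel fun x => (t.symm x).1 := by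
  rw [SetPartition.isKernel_iff_mem_part]
  intro x y
  have hy : t.rowSet (t.symm y).1 ∈ π.parts := by
    rw [← ht.image_rowSet]
    exact Finset.mem_image_of_mem _ (Finset.mem_univ _)
  rw [π.part_eq_of_mem hy ((mem_rowSet t _ y).2 rfl), mem_rowSet]

theorem perm_injective : Function.Injective (perm : YoungTableau lam → Equiv.Perm (Fin n)) := by
  intro t t' h
  ext b : 1
  simpa [perm] using congrArg (fun δ : Equiv.Perm (Fin n) => δ (readingOrder lam b)) h

open Classical in
theorem card_filter_rowEquiv (t : YoungTableau lam) :
    #{t' : YoungTableau lam | t.RowEquiv t'} = partFactorial lam := by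
  have h : #{g : Equiv.Perm (Box lam) | Sigma.fst ∘ g = Sigma.fst} = partFactorial lam := by
    rw [card_perm_comp_eq, partFactorial_eq_prod]
    have himg : Finset.univ.image (Sigma.fst : Box lam → _) = Finset.univ := by
      ext i
      simp only [Finset.mem_image, Finset.mem_univ, true_and, iff_true]
      exact ⟨⟨i, ⟨0, rows_pos lam i⟩⟩, rfl⟩
    rw [himg]
    refine Finset.prod_congr rfl fun i _ => ?_
    congr 1
    have hc := card_finSigma_fst _ t i
    rw [← hc]
    exact Finset.card_equiv t (by simp)
  rw [← h]
  refine Finset.card_bij (fun t' _ => t.trans t'.symm) ?_ ?_ ?_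
  · intro t' ht'
    simp only [Finset.mem_filter, Finset.mem_univ, true_and, rowEquiv_iff] at ht' ⊢
    funext b
    have := ht' (t b)
    simpa using this.symm
  · intro t₁ _ t₂ _ he
    have : t₁.symm = t₂.symm := by
      ext x : 1
      simpa using congrArg (fun g : Equiv.Perm (Box lam) => g (t.symm x)) he
    exact Equiv.symm_bijective.injective this
  · intro g hg
    refine ⟨g.symm.trans t, ?_, ?_⟩
    · simp only [Finset.mem_filter, Finset.mem_univ, true_and, rowEquiv_iff] at hg ⊢
      intro x
      have := congrFun hg (t.symm x)
      simpa using this.symm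
    · ext b : 1
      simp

end YoungTableau

/-- The leading term of the tabloid function of `π` is `h_π`: the action of `δ_{t'}` takes the
set partition into the rows in reading order to the one into the rows of `t'`, so each of the
`λ(π)!` summands contributes `h_π / λ(π)!`. -/
theorem tabloidSchur_sub_complete_mem {n : ℕ} (π : SetPartition n) :
    tabloidSchur π.tableau - π.complete ∈ Submodule.span ℚ
      (SetPartition.complete '' {σ : SetPartition n | π.pairCount < σ.pairCount}) := by
  classical
  obtain ⟨κ, hκ⟩ := SetPartition.exists_isKernel fun x => ((readingOrder π.shape).symm x).1
  have hperm : ∀ t' : YoungTableau π.shape, π.tableau.RowEquiv t' →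
      SetPartition.perm t'.perm κ = π := by
    intro t' ht'
    refine (hκ.perm t'.perm).unique ?_
    have e : ((fun x => ((readingOrder π.shape).symm x).1) ∘ ⇑t'.perm.symm) =
        fun x => (π.tableau.symm x).1 := by
      funext x
      rw [YoungTableau.rowEquiv_iff.1 ht' x]
      simp [YoungTableau.perm]
    rw [e]
    exact π.tableau_represents.isKernel
  have hcount : π.pairCount = κ.pairCount := by
    rw [← hperm π.tableau fun _ => rfl, SetPartition.pairCount_perm]
  have hne : (partFactorial π.shape : ℚ) ≠ 0 := by
    rw [partFactorial_eq_prod]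
    exact_mod_cast Finset.prod_ne_zero_iff.2 fun i _ => Nat.factorial_ne_zero _
  have e : π.complete = ∑ t' : YoungTableau π.shape with π.tableau.RowEquiv t',
      (partFactorial π.shape : ℚ)⁻¹ • π.complete := by
    rw [Finset.sum_const, YoungTableau.card_filter_rowEquiv, ← Nat.cast_smul_eq_nsmul ℚ,
      smul_smul, mul_inv_cancel₀ hne, one_smul]
  rw [tabloidSchur]
  conv =>
    congr
    · skip
    · rw [e]
  rw [← Finset.sum_sub_distrib]
  refine Submodule.sum_mem _ fun t' ht' => ?_
  have h := SetPartition.permAct_mem_span t'.perm _ (sourceSchur_sub_mem π.shape hκ)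
  rwa [map_sub, map_smul, SetPartition.permAct_complete, hperm t' (Finset.mem_filter.1 ht').2,
    ← hcount] at h

theorem sourceSchur_mem_span {n : ℕ} (lam : n.Partition) :
    sourceSchur lam ∈ Submodule.span ℚ (Set.range fun π : SetPartition n => π.complete) := by
  obtain ⟨κ, hκ⟩ := SetPartition.exists_isKernel fun x => ((readingOrder lam).symm x).1
  rw [← sub_add_cancel (sourceSchur lam) ((partFactorial lam : ℚ)⁻¹ • κ.complete)]
  exact Submodule.add_mem _
    (Submodule.span_mono (Set.image_subset_range _ _) (sourceSchur_sub_mem lam hκ))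
    (Submodule.smul_mem _ _ (Submodule.subset_span ⟨κ, rfl⟩))

/-! ### A basis of NCSym -/

/-- In each degree the tabloid functions of the set partitions are linearly independent and span
the same space as the `m_π`. -/
theorem linearIndependent_tabloidSchur (n : ℕ) :
    LinearIndependent ℚ (fun π : SetPartition n => tabloidSchur π.tableau) ∧
      Submodule.span ℚ (Set.range fun π : SetPartition n => tabloidSchur π.tableau) =
        Submodule.span ℚ (Set.range fun π : SetPartition n => π.monomial) := by
  rw [← SetPartition.span_complete_eq_span_monomial]
  exact linearIndependent_of_unitriangular SetPartition.pairCount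
    SetPartition.linearIndependent_complete tabloidSchur_sub_complete_mem

/-- The component of degree `n` of a series. -/
noncomputable def NCSeries.homogeneousPart (n : ℕ) : NCSeries →ₗ[ℚ] NCSeries where
  toFun f := ⟨fun w => if w.length = n then f.coeff w else 0⟩
  map_add' f g := by
    ext w
    simp only [NCSeries.coeff_add]
    split_ifs <;> simp
  map_smul' c f := by
    ext w
    simp [NCSeries.coeff_smul]

theorem homogeneousPart_of_mem_span {n : ℕ} {f : NCSeries}
    (hf : f ∈ Submodule.span ℚ (Set.range fun π : SetPartition n => π.monomial)) (m : ℕ) :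
    NCSeries.homogeneousPart m f = if n = m then f else 0 := by
  have h : Set.EqOn (NCSeries.homogeneousPart m)
      ((if n = m then LinearMap.id else 0 : NCSeries →ₗ[ℚ] NCSeries))
      (Submodule.span ℚ (Set.range fun π : SetPartition n => π.monomial)) := by
    refine LinearMap.eqOn_span ?_
    rintro _ ⟨π, rfl⟩
    ext w
    by_cases hw : w.length = n
    · by_cases hm : n = m <;>
        simp [NCSeries.homogeneousPart, hw, hm, NCSeries.coeff_zero]
    · have h₀ : π.monomial.coeff w = 0 := by simp [SetPartition.monomial, hw]
      by_cases hm : n = m <;>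
        simp [NCSeries.homogeneousPart, hm, h₀, NCSeries.coeff_zero]
  rw [h hf]
  split_ifs <;> rfl

theorem linearIndependent_sigma_of_homogeneous {ι : ℕ → Type*} (v : ∀ n, ι n → NCSeries)
    (hv : ∀ n, LinearIndependent ℚ (v n))
    (hm : ∀ n i m, NCSeries.homogeneousPart m (v n i) = if n = m then v n i else 0) :
    LinearIndependent ℚ fun p : Σ n, ι n => v p.1 p.2 := by
  classical
  rw [linearIndependent_iff]
  intro l hl
  have key : ∀ m, (NCSeries.homogeneousPart m).comp
      (Finsupp.linearCombination ℚ fun p : Σ n, ι n => v p.1 p.2) =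
      (Finsupp.linearCombination ℚ (v m)).comp
        (Finsupp.lcomapDomain (Sigma.mk m) sigma_mk_injective) := by
    intro m
    refine Finsupp.lhom_ext' fun ⟨n, i⟩ => LinearMap.ext_ring ?_
    simp only [LinearMap.comp_apply, Finsupp.lsingle_apply, Finsupp.linearCombination_single,
      one_smul, hm]
    by_cases h : n = m
    · subst h
      have e : Finsupp.lcomapDomain (R := ℚ) (Sigma.mk n) sigma_mk_injective
          (Finsupp.single (⟨n, i⟩ : Σ n, ι n) (1 : ℚ)) = Finsupp.single i 1 := by
        ext j
        simp [Finsupp.lcomapDomain, Finsupp.single_apply]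
      rw [if_pos rfl, e, Finsupp.linearCombination_single, one_smul]
    · have e : Finsupp.lcomapDomain (R := ℚ) (Sigma.mk m) sigma_mk_injective
          (Finsupp.single (⟨n, i⟩ : Σ n, ι n) (1 : ℚ)) = 0 := by
        ext j
        simp [Finsupp.lcomapDomain, h]
      rw [if_neg h, e, map_zero]
  ext ⟨m, i⟩
  have h := LinearMap.congr_fun (key m) l
  rw [LinearMap.comp_apply, hl, map_zero, LinearMap.comp_apply] at h
  have h' := (linearIndependent_iff.1 (hv m)) _ h.symm
  simpa using DFunLike.congr_fun h' i

/-! ### Letting the variables commute -/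

namespace NCSeries

theorem rho_apply (f : NCSeries) (d : ℕ →₀ ℕ) :
    MvPowerSeries.coeff d (rho f) =
      ∑ w ∈ (Multiset.lists (Finsupp.toMultiset d)).toFinset, f.coeff w := rfl

theorem mem_lists_toMultiset {d : ℕ →₀ ℕ} {w : List ℕ} :
    w ∈ (Multiset.lists (Finsupp.toMultiset d)).toFinset ↔
      Multiset.toFinsupp (w : Multiset ℕ) = d := by
  rw [Multiset.mem_toFinset, Multiset.mem_lists_iff, Multiset.quot_mk_to_coe, eq_comm,
    ← Multiset.toFinsupp.apply_eq_iff_eq, Finsupp.toMultiset_toFinsupp]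

theorem rho_one : rho 1 = 1 := by
  classical
  ext d
  rw [rho_apply, MvPowerSeries.coeff_one]
  simp only [coeff_one, Finset.sum_ite_eq', mem_lists_toMultiset]
  simp [eq_comm]

theorem rho_mul (f g : NCSeries) : rho (f * g) = rho f * rho g := by
  classical
  ext d
  rw [rho_apply, MvPowerSeries.coeff_mul]
  simp only [coeff_mul, rho_apply, Finset.sum_mul_sum, ← Finset.sum_product', Finset.sum_sigma']
  refine Finset.sum_nbij'
    (fun x => ⟨(Multiset.toFinsupp ((x.1.take x.2.1 : List ℕ) : Multiset ℕ),
      Multiset.toFinsupp ((x.1.drop x.2.1 : List ℕ) : Multiset ℕ)),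
        (x.1.take x.2.1, x.1.drop x.2.1)⟩)
    (fun y => ⟨y.2.1 ++ y.2.2, (y.2.1.length, y.2.2.length)⟩) ?_ ?_ ?_ ?_ ?_
  · rintro ⟨w, i, j⟩ hx
    simp only [Finset.mem_sigma, mem_lists_toMultiset, Finset.HasAntidiagonal.mem_antidiagonal,
      Finset.mem_product] at hx ⊢
    rw [← map_add, Multiset.coe_add, List.take_append_drop]
    exact ⟨hx.1, trivial, trivial⟩
  · rintro ⟨⟨d₁, d₂⟩, u, v⟩ hx
    simp only [Finset.mem_sigma, mem_lists_toMultiset, Finset.HasAntidiagonal.mem_antidiagonal,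
      Finset.mem_product] at hx ⊢
    obtain ⟨h, rfl, rfl⟩ := hx
    rw [← Multiset.coe_add, map_add]
    exact ⟨h, by simp⟩
  · rintro ⟨w, i, j⟩ hx
    simp only [Finset.mem_sigma, Finset.HasAntidiagonal.mem_antidiagonal] at hx
    have h₁ : min i w.length = i := by omega
    have h₂ : w.length - i = j := by omega
    simp [h₁, h₂]
  · rintro ⟨⟨d₁, d₂⟩, u, v⟩ hx
    simp only [Finset.mem_sigma, mem_lists_toMultiset, Finset.HasAntidiagonal.mem_antidiagonal,
      Finset.mem_product] at hx
    obtain ⟨h, rfl, rfl⟩ := hx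
    simp
  · rintro ⟨w, i, j⟩ hx
    rfl

/-- `rho` as a ring homomorphism. -/
noncomputable def rhoHom : NCSeries →+* MvPowerSeries ℕ ℚ :=
  { rho with
    map_one' := rho_one
    map_mul' := rho_mul
    map_zero' := map_zero rho }

theorem rhoHom_apply (f : NCSeries) : rhoHom f = rho f := rfl

theorem rho_det {k : ℕ} (A : Fin k → Fin k → NCSeries) :
    rho (det A) = Matrix.det (Matrix.of fun i j => rho (A i j)) := by
  rw [det, ← rhoHom_apply, map_sum, ← Matrix.det_transpose, Matrix.det_apply]
  refine Finset.sum_congr rfl fun ε _ => ?_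
  rw [map_zsmul, map_list_prod, List.map_ofFn, List.prod_ofFn]
  rfl

theorem length_eq_degree {d : ℕ →₀ ℕ} {w : List ℕ}
    (hw : w ∈ (Multiset.lists (Finsupp.toMultiset d)).toFinset) : w.length = d.degree := by
  rw [Multiset.mem_toFinset, Multiset.mem_lists_iff, Multiset.quot_mk_to_coe] at hw
  rw [← Multiset.coe_card, ← hw, Finsupp.card_toMultiset]
  rfl

theorem ofFn_comp_mem_lists {n : ℕ} {d : ℕ →₀ ℕ} {u : Fin n → ℕ} (g : Equiv.Perm (Fin n)) :
    List.ofFn (u ∘ g) ∈ (Multiset.lists (Finsupp.toMultiset d)).toFinset ↔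
      List.ofFn u ∈ (Multiset.lists (Finsupp.toMultiset d)).toFinset := by
  rw [mem_lists_toMultiset, mem_lists_toMultiset, Multiset.coe_eq_coe.2 (g.ofFn_comp_perm u)]

theorem permAct_coeff_ofFn {n : ℕ} (δ : Equiv.Perm (Fin n)) (f : NCSeries) (u : Fin n → ℕ) :
    (permAct δ f).coeff (List.ofFn u) = f.coeff (List.ofFn (u ∘ δ)) := by
  simp [permAct, Function.comp_def]

theorem exists_eq_ofFn {n : ℕ} {w : List ℕ} (hw : w.length = n) :
    ∃ u : Fin n → ℕ, w = List.ofFn u := by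
  subst hw
  exact ⟨w.get, (List.ofFn_get w).symm⟩

theorem rho_permAct {n : ℕ} (δ : Equiv.Perm (Fin n)) {f : NCSeries}
    (hf : ∀ w : List ℕ, w.length ≠ n → f.coeff w = 0) : rho (permAct δ f) = rho f := by
  ext d
  rw [rho_apply, rho_apply]
  by_cases hd : d.degree = n
  · have get_ofFn : ∀ (g : Equiv.Perm (Fin n)) (u : Fin n → ℕ),
        (List.ofFn fun i => (List.ofFn u).getD (g i) 0) = List.ofFn (u ∘ g) := by
      intro g u
      congr 1
      funext i
      simp
    refine Finset.sum_nbij' (fun w => List.ofFn fun i => w.getD (δ i) 0)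
      (fun w => List.ofFn fun i => w.getD (δ.symm i) 0) ?_ ?_ ?_ ?_ ?_
    all_goals
      intro w hw
      obtain ⟨u, rfl⟩ := exists_eq_ofFn ((length_eq_degree hw).trans hd)
      simp only [get_ofFn]
    · exact (ofFn_comp_mem_lists δ).2 hw
    · exact (ofFn_comp_mem_lists δ.symm).2 hw
    · simp [Function.comp_def]
    · simp [Function.comp_def]
    · exact permAct_coeff_ofFn δ f u
  · rw [Finset.sum_eq_zero, Finset.sum_eq_zero]
    · exact fun w hw => hf w ((length_eq_degree hw).trans_ne hd)
    · intro w hw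
      simp [permAct, (length_eq_degree hw).trans_ne hd]

theorem exists_perm_of_ofFn_perm {n : ℕ} {u v : Fin n → ℕ}
    (h : (List.ofFn u).Perm (List.ofFn v)) : ∃ g : Equiv.Perm (Fin n), u = v ∘ g := by
  have e : u ∘ Tuple.sort u = v ∘ Tuple.sort v := List.ofFn_injective <|
    (((Tuple.sort u).ofFn_comp_perm u).trans
      (h.trans ((Tuple.sort v).ofFn_comp_perm v).symm)).eq_of_pairwise'
      (Tuple.monotone_sort u).sortedLE_ofFn.pairwise
      (Tuple.monotone_sort v).sortedLE_ofFn.pairwise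
  refine ⟨(Tuple.sort u).symm.trans (Tuple.sort v), ?_⟩
  funext x
  simpa using congrFun e ((Tuple.sort u).symm x)

/-- The coefficient of a word in `h_[k]` is the order of its stabilizer in `𝔖_k`, and the words
that are rearrangements of a given one form an orbit; so each monomial of degree `k` has the
coefficient `k!` in `ρ(h_[k])`. -/
theorem rho_complete_top (k : ℕ) :
    rho (⊤ : SetPartition k).complete = (k.factorial : ℚ) • commComplete k := by
  classical
  ext d
  rw [rho_apply, MvPowerSeries.coeff_smul]
  change _ = (k.factorial : ℚ) * if (d.degree : ℤ) = k then 1 else 0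
  by_cases hd : d.degree = k
  · obtain ⟨u₀, hu₀⟩ : ∃ u₀ : Fin k → ℕ, (Finsupp.toMultiset d).toList = List.ofFn u₀ :=
      exists_eq_ofFn (by
        rw [Multiset.length_toList, Finsupp.card_toMultiset]
        exact hd)
    have hmem : List.ofFn u₀ ∈ (Multiset.lists (Finsupp.toMultiset d)).toFinset := by
      rw [← hu₀, mem_lists_toMultiset, Multiset.coe_toList, Finsupp.toMultiset_toFinsupp]
    have hcoeff : ∀ w ∈ (Multiset.lists (Finsupp.toMultiset d)).toFinset,
        (⊤ : SetPartition k).complete.coeff w =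
          (#{g : Equiv.Perm (Fin k) | List.ofFn (u₀ ∘ g) = w} : ℚ) := by
      intro w hw
      obtain ⟨u, rfl⟩ := exists_eq_ofFn ((length_eq_degree hw).trans hd)
      obtain ⟨h, rfl⟩ : ∃ h : Equiv.Perm (Fin k), u = u₀ ∘ h := by
        refine exists_perm_of_ofFn_perm (Multiset.coe_eq_coe.1 ?_)
        rw [← Multiset.toFinsupp.apply_eq_iff_eq, mem_lists_toMultiset.1 hw,
          mem_lists_toMultiset.1 hmem]
      obtain ⟨σ, hσ⟩ := SetPartition.exists_isKernel (u₀ ∘ h)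
      rw [hσ.complete_coeff, inf_top_eq, hσ.partFactorial_shape, ← card_perm_comp_eq]
      congr 1
      refine Finset.card_equiv (Equiv.mulLeft h) fun g => ?_
      simp only [Finset.mem_filter, Finset.mem_univ, true_and, Equiv.coe_mulLeft,
        List.ofFn_injective.eq_iff, Equiv.Perm.coe_mul, Function.comp_assoc]
    rw [Finset.sum_congr rfl hcoeff, ← Nat.cast_sum, ← Finset.card_eq_sum_card_fiberwise
      fun g _ => Finset.mem_coe.2 ((ofFn_comp_mem_lists g).2 hmem), Finset.card_univ,
      Fintype.card_perm, Fintype.card_fin, if_pos (by exact_mod_cast hd), mul_one]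
  · rw [Finset.sum_eq_zero, if_neg (by exact_mod_cast hd), mul_zero]
    exact fun w hw =>
      SetPartition.complete_coeff_of_length_ne _ ((length_eq_degree hw).trans_ne hd)

theorem rho_normComplete (k : ℤ) : rho (normComplete k) = commComplete k := by
  rw [normComplete]
  split_ifs with hk
  · rw [map_smul, rho_complete_top, smul_smul, inv_mul_cancel₀ (by positivity), one_smul,
      Int.toNat_of_nonneg hk]
  · rw [map_zero]
    funext d
    exact (if_neg (by omega)).symm

end NCSeries

theorem rho_sourceSchur {n : ℕ} (lam : n.Partition) :
    NCSeries.rho (sourceSchur lam) = schur lam := by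
  simp only [sourceSchur, NCSeries.rho_det, NCSeries.rho_normComplete, schur]

theorem sourceSchur_coeff_of_length_ne {n : ℕ} (lam : n.Partition) (w : List ℕ)
    (hw : w.length ≠ n) : (sourceSchur lam).coeff w = 0 := by
  refine Submodule.span_induction (p := fun f _ => f.coeff w = 0) ?_ rfl ?_ ?_
    (sourceSchur_mem_span lam)
  · rintro _ ⟨π, rfl⟩
    exact π.complete_coeff_of_length_ne hw
  · intro f g _ _ hf hg
    rw [NCSeries.coeff_add, hf, hg, add_zero]
  · intro c f _ hf
    rw [NCSeries.coeff_smul, hf, mul_zero]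

theorem rho_tabloidSchur {n : ℕ} {lam : n.Partition} (t : YoungTableau lam) :
    NCSeries.rho (tabloidSchur t) = (partFactorial lam : ℚ) • schur lam := by
  have h : ∀ t' : YoungTableau lam, NCSeries.rho (tableauSchur t') = schur lam := fun t' => by
    rw [tableauSchur, NCSeries.rho_permAct _ (sourceSchur_coeff_of_length_ne lam),
      rho_sourceSchur]
  rw [tabloidSchur, map_sum, Finset.sum_congr rfl fun t' _ => h t', Finset.sum_const,
    YoungTableau.card_filter_rowEquiv, Nat.cast_smul_eq_nsmul]

theorem tabloidSchur_mem_span {n : ℕ} (π : SetPartition n) :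
    tabloidSchur π.tableau ∈
      Submodule.span ℚ (Set.range fun π : SetPartition n => π.monomial) :=
  (linearIndependent_tabloidSchur n).2 ▸ Submodule.subset_span ⟨π, rfl⟩

theorem span_tabloidSchur_eq_NCSym :
    Submodule.span ℚ (Set.range fun p : Σ n, SetPartition n => tabloidSchur p.2.tableau) =
      NCSym := by
  rw [NCSym, Set.range_sigma_eq_iUnion_range, Set.range_sigma_eq_iUnion_range,
    Submodule.span_iUnion, Submodule.span_iUnion]
  exact iSup_congr fun n => (linearIndependent_tabloidSchur n).2

end NCS

theorem theorem4p10 :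
    (∃ b : Module.Basis (Σ n : ℕ, NCS.SetPartition n) ℚ NCS.NCSym,
      ∀ (n : ℕ) (π : NCS.SetPartition n) (t : NCS.YoungTableau π.shape),
        NCS.YoungTableau.perm t = π.delta → (b ⟨n, π⟩ : NCS.NCSeries) = NCS.tabloidSchur t) ∧
    ∀ (n : ℕ) (lam : n.Partition) (t : NCS.YoungTableau lam),
      NCS.NCSeries.rho (NCS.tabloidSchur t) = (NCS.partFactorial lam : ℚ) • NCS.schur lam := by
  refine ⟨?_, fun n lam t => NCS.rho_tabloidSchur t⟩
  have hli := NCS.linearIndependent_sigma_of_homogeneous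
    (fun n (π : NCS.SetPartition n) => NCS.tabloidSchur π.tableau)
    (fun n => (NCS.linearIndependent_tabloidSchur n).1)
    (fun n π m => NCS.homogeneousPart_of_mem_span (NCS.tabloidSchur_mem_span π) m)
  refine ⟨(Module.Basis.span hli).map
    (LinearEquiv.ofEq _ _ NCS.span_tabloidSchur_eq_NCSym), fun n π t ht => ?_⟩
  rw [NCS.YoungTableau.perm_injective ht, Module.Basis.map_apply, LinearEquiv.coe_ofEq_apply,
    Module.Basis.span_apply]
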